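/- Let $R$ be a commutative artinian ring and let $A$ and $B$ be Artin $R$-algebras (that is, $R$-algebras which are finitely generated as $R$-modules). Let ${}_BM_A$ and ${}_AN_B$ be bimodules on which $R$ acts centrally and which are finitely generated as $R$-modules. Let $\phi: M\otimes_A N\to B$ and $\psi: N\otimes_B M\to A$ be bimodule homomorphisms such that $\phi(m\otimes n)m'=m\psi(n\otimes m')$ and $n\phi(m\otimes n')=\psi(n\otimes m)n'$ for all $m,m'\in M$, $n,n'\in N$. Let $\Lambda=\begin{pmatrix}A&N\\M&B\end{pmatrix}$ be the associated Morita ring, with multiplication $$\begin{pmatrix}a&n\\m&b\end{pmatrix}\begin{pmatrix}a'&n'\\m'&b'\end{pmatrix}=\begin{pmatrix}aa'+\psi(n\otimes m')&an'+nb'\\ma'+bm'&bb'+\phi(m\otimes n')\end{pmatrix}.$$ Assume that $M\otimes_A N=0=N\otimes_B M$ (hence $\phi=0=\psi$) and that ${}_BM$, $M_A$, ${}_AN$ and $N_B$ are projective modules. For a finitely generated left $A$-module $X$, a finitely generated left $B$-module $Y$, a $B$-homomorphism $f:M\otimes_A X\to Y$ and an $A$-homomorphism $g:N\otimes_B Y\to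 X$, let $\begin{pmatrix}X\\Y\end{pmatrix}_{f,g}$ be the left $\Lambda$-module of column vectors with action $$\begin{pmatrix}a&n\\m&b\end{pmatrix}\begin{pmatrix}x\\y\end{pmatrix}=\begin{pmatrix}ax+g(n\otimes y)\\f(m\otimes x)+by\end{pmatrix}.$$ For a ring $S$, a complete projective resolution in the category of finitely generated left $S$-modules is an exact complex $P^\bullet:\cdots\to P^{-1}\to P^0\xrightarrow{d_0}P^1\to\cdots$ of finitely generated projective left $S$-modules such that $\operatorname{Hom}_S(P^\bullet,Q)$ is exact for every finitely generated projective left $S$-module $Q$. Let $\mathrm{GP}(S)$ be the class of Gorenstein-projective $S$-modules, i.e. of the modules isomorphic to $\operatorname{Ker} d_0$ for some such $P^\bullet$. Then $\begin{pmatrix}X\\Y\end{pmatrix}_{f,g}\in\mathrm{GP}(\Lambda)$ if and only if $f$ and $g$ are injective, $\operatorname{Coker} f\in\mathrm{GP}(B)$ and $\operatorname{Coker} g\in\mathrm{GP}(A)$. -/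

import Mathlib

open scoped TensorProduct
open MulOpposite (op)

universe u

/-! ### Tensor products over a noncommutative ring

A right `A`-module is a module over the opposite ring `Aᵐᵒᵖ`; the right action `m * a` is `op a • m`.
A `B`-`A`-bimodule has commuting actions of `B` and `Aᵐᵒᵖ`. -/

section BalancedTensor

variable (A : Type*) [Ring A]
variable (M : Type*) [AddCommGroup M] [Module Aᵐᵒᵖ M]
variable (X : Type*) [AddCommGroup X] [Module A X]

/-- The subgroup of `M ⊗_ℤ X` generated by all `(m * a) ⊗ x - m ⊗ (a * x)`. -/
def balancedRelations : AddSubgroup (M ⊗[ℤ] X) :=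
  AddSubgroup.closure
    {t | ∃ (m : M) (a : A) (x : X), t = (op a • m) ⊗ₜ[ℤ] x - m ⊗ₜ[ℤ] (a • x)}

/-- The tensor product `M ⊗_A X` of a right `A`-module `M` and a left `A`-module `X` over an
arbitrary ring `A`. -/
def BalancedTensor : Type _ := (M ⊗[ℤ] X) ⧸ balancedRelations A M X

namespace BalancedTensor

instance : AddCommGroup (BalancedTensor A M X) :=
  inferInstanceAs (AddCommGroup ((M ⊗[ℤ] X) ⧸ balancedRelations A M X))

variable {M X}

/-- The pure tensor `m ⊗ x` in `M ⊗_A X`. -/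
def tmul (m : M) (x : X) : BalancedTensor A M X :=
  QuotientAddGroup.mk' (balancedRelations A M X) (m ⊗ₜ[ℤ] x)

variable {A}

theorem tmul_add (m : M) (x x' : X) : tmul A m (x + x') = tmul A m x + tmul A m x' := by
  simp only [tmul, TensorProduct.tmul_add, map_add]; rfl

theorem add_tmul (m m' : M) (x : X) : tmul A (m + m') x = tmul A m x + tmul A m' x := by
  simp only [tmul, TensorProduct.add_tmul, map_add]; rfl

theorem tmul_zero (m : M) : tmul A m (0 : X) = 0 := by
  have h := tmul_add (A := A) m (0 : X) 0
  simpa using h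

theorem zero_tmul (x : X) : tmul A (0 : M) x = 0 := by
  have h := add_tmul (A := A) (0 : M) 0 x
  simpa using h

theorem smul_tmul (m : M) (a : A) (x : X) : tmul A (op a • m) x = tmul A m (a • x) := by
  refine (QuotientAddGroup.eq_iff_sub_mem).2 ?_
  exact AddSubgroup.subset_closure ⟨m, a, x, rfl⟩

@[elab_as_elim]
theorem induction_on {p : BalancedTensor A M X → Prop} (t : BalancedTensor A M X)
    (zero : p 0) (tmul : ∀ m x, p (tmul A m x)) (add : ∀ s t, p s → p t → p (s + t)) : p t := by
  obtain ⟨t, rfl⟩ := QuotientAddGroup.mk'_surjective (balancedRelations A M X) t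
  induction t with
  | zero => exact zero
  | tmul m x => exact tmul m x
  | add s t hs ht => exact add _ _ hs ht

/-- The additive map on `M ⊗_A X` induced by an `A`-balanced biadditive map. -/
def lift {G : Type*} [AddCommGroup G] (h : M →+ X →+ G)
    (hh : ∀ m (a : A) x, h (op a • m) x = h m (a • x)) : BalancedTensor A M X →+ G :=
  QuotientAddGroup.lift (balancedRelations A M X)
    (TensorProduct.liftAddHom h (fun r m x => by simp)) (by
      rw [balancedRelations, AddSubgroup.closure_le]
      rintro _ ⟨m, a, x, rfl⟩
      simp [hh])

@[simp]
theorem lift_tmul {G : Type*} [AddCommGroup G] (h : M →+ X →+ G)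
    (hh : ∀ m (a : A) x, h (op a • m) x = h m (a • x)) (m : M) (x : X) :
    lift h hh (tmul A m x) = h m x := rfl

variable {B : Type*} [Ring B] [Module B M] [SMulCommClass B Aᵐᵒᵖ M]

/-- The action of `b : B` on `M ⊗_A X`, with `b (m ⊗ x) = (b m) ⊗ x`. -/
def lsmul (b : B) : BalancedTensor A M X →+ BalancedTensor A M X :=
  lift (AddMonoidHom.mk' (fun m => AddMonoidHom.mk' (fun x => tmul A (b • m) x)
      (fun x x' => tmul_add _ x x'))
      (fun m m' => by ext x; simp [smul_add, add_tmul]))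
    (fun m a x => by simp [smul_comm b (op a) m, smul_tmul])

theorem lsmul_tmul (b : B) (m : M) (x : X) : lsmul b (tmul A m x) = tmul A (b • m) x := rfl

/-- If `M` is a `B`-`A`-bimodule, then `M ⊗_A X` is a left `B`-module. -/
instance : Module B (BalancedTensor A M X) where
  smul b t := lsmul b t
  smul_zero b := map_zero (lsmul b)
  smul_add b := map_add (lsmul b)
  one_smul t := by
    change lsmul (1 : B) t = t
    induction t using induction_on with
    | zero => exact map_zero _
    | tmul m x => rw [lsmul_tmul, one_smul]
    | add s t hs ht => rw [map_add, hs, ht]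
  mul_smul b b' t := by
    change lsmul (b * b') t = lsmul b (lsmul b' t)
    induction t using induction_on with
    | zero => simp only [map_zero]
    | tmul m x => simp only [lsmul_tmul, mul_smul]
    | add s t hs ht => simp only [map_add, hs, ht]
  add_smul b b' t := by
    change lsmul (b + b') t = lsmul b t + lsmul b' t
    induction t using induction_on with
    | zero => simp only [map_zero, add_zero]
    | tmul m x => simp only [lsmul_tmul, add_smul, add_tmul]
    | add s t hs ht => simp only [map_add, hs, ht]; abel
  zero_smul t := by
    change lsmul (0 : B) t = 0
    induction t using induction_on with
    | zero => exact map_zero _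
    | tmul m x => rw [lsmul_tmul, zero_smul, zero_tmul]
    | add s t hs ht => rw [map_add, hs, ht, add_zero]

theorem smul_tmul_left (b : B) (m : M) (x : X) : b • tmul A m x = tmul A (b • m) x := rfl

end BalancedTensor

end BalancedTensor

/-! ### Gorenstein-projective modules -/

/-- A complete projective resolution in the category of finitely generated left `A`-modules:
an exact complex `⋯ ⟶ P (-1) ⟶ P 0 ⟶ P 1 ⟶ ⋯` of finitely generated projective `A`-modules
such that `Hom_A(P, Q)` is exact for every finitely generated projective `A`-module `Q`. -/
structure CompleteProjectiveResolution (A : Type u) [Ring A] where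
  P : ℤ → Type u
  [addCommGroup : ∀ i, AddCommGroup (P i)]
  [module : ∀ i, Module A (P i)]
  [finite : ∀ i, Module.Finite A (P i)]
  [projective : ∀ i, Module.Projective A (P i)]
  d : ∀ i, P i →ₗ[A] P (i + 1)
  exact : ∀ i, Function.Exact (d i) (d (i + 1))
  hom_exact : ∀ (Q : Type u) [AddCommGroup Q] [Module A Q] [Module.Finite A Q]
    [Module.Projective A Q] (i : ℤ),
    Function.Exact (fun h : P (i + 1 + 1) →ₗ[A] Q => h ∘ₗ d (i + 1))
      (fun h : P (i + 1) →ₗ[A] Q => h ∘ₗ d i)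

attribute [instance] CompleteProjectiveResolution.addCommGroup
  CompleteProjectiveResolution.module CompleteProjectiveResolution.finite
  CompleteProjectiveResolution.projective

/-- A module `G` is (finitely generated) Gorenstein-projective if it is isomorphic to the kernel
of the differential `d 0` of a complete projective resolution. -/
def IsGorensteinProjective (A : Type u) [Ring A] (G : Type*) [AddCommGroup G] [Module A G] : Prop :=
  ∃ T : CompleteProjectiveResolution A, Nonempty (G ≃ₗ[A] LinearMap.ker (T.d 0))

/-! ### Morita rings -/

section Morita

variable (A B M N : Type*) [Ring A] [Ring B]
variable [AddCommGroup M] [Module B M] [Module Aᵐᵒᵖ M] [SMulCommClass B Aᵐᵒᵖ M]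
variable [AddCommGroup N] [Module A N] [Module Bᵐᵒᵖ N] [SMulCommClass A Bᵐᵒᵖ N]

open BalancedTensor (tmul)

/-- The structure maps of a Morita ring with corners `A`, `B` and bimodules `_B M_A`, `_A N_B`:
bimodule homomorphisms `φ : M ⊗_A N → B` and `ψ : N ⊗_B M → A` (the left linearity is bundled)
with `φ(m ⊗ n) m' = m ψ(n ⊗ m')` and `n φ(m ⊗ n') = ψ(n ⊗ m) n'`. -/
structure MoritaDatum where
  φ : BalancedTensor A M N →ₗ[B] B
  φ_right : ∀ (m : M) (n : N) (b : B), φ (tmul A m (op b • n)) = φ (tmul A m n) * b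
  ψ : BalancedTensor B N M →ₗ[A] A
  ψ_right : ∀ (n : N) (m : M) (a : A), ψ (tmul B n (op a • m)) = ψ (tmul B n m) * a
  φ_smul : ∀ (m m' : M) (n : N), φ (tmul A m n) • m' = op (ψ (tmul B n m')) • m
  smul_φ : ∀ (m : M) (n n' : N), op (φ (tmul A m n')) • n = ψ (tmul B n m) • n'

variable {A B M N}

/-- The elements of the Morita ring: the matrices `(a n; m b)`. -/
@[ext]
structure MoritaRing (C : MoritaDatum A B M N) where
  a : A
  n : N
  m : M
  b : B

namespace MoritaRing

variable (C : MoritaDatum A B M N)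

instance : Zero (MoritaRing C) := ⟨⟨0, 0, 0, 0⟩⟩
instance : One (MoritaRing C) := ⟨⟨1, 0, 0, 1⟩⟩
instance : Add (MoritaRing C) := ⟨fun s t => ⟨s.a + t.a, s.n + t.n, s.m + t.m, s.b + t.b⟩⟩
instance : Neg (MoritaRing C) := ⟨fun s => ⟨-s.a, -s.n, -s.m, -s.b⟩⟩

/-- Matrix multiplication:
`(a n; m b) (a' n'; m' b') = (aa' + ψ(n ⊗ m'), an' + nb'; ma' + bm', bb' + φ(m ⊗ n'))`. -/
instance : Mul (MoritaRing C) :=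
  ⟨fun s t => ⟨s.a * t.a + C.ψ (tmul B s.n t.m), s.a • t.n + op t.b • s.n,
    op t.a • s.m + s.b • t.m, s.b * t.b + C.φ (tmul A s.m t.n)⟩⟩

@[simp] theorem zero_a : (0 : MoritaRing C).a = 0 := rfl
@[simp] theorem zero_n : (0 : MoritaRing C).n = 0 := rfl
@[simp] theorem zero_m : (0 : MoritaRing C).m = 0 := rfl
@[simp] theorem zero_b : (0 : MoritaRing C).b = 0 := rfl
@[simp] theorem one_a : (1 : MoritaRing C).a = 1 := rfl
@[simp] theorem one_n : (1 : MoritaRing C).n = 0 := rfl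
@[simp] theorem one_m : (1 : MoritaRing C).m = 0 := rfl
@[simp] theorem one_b : (1 : MoritaRing C).b = 1 := rfl

variable {C}

@[simp] theorem add_a (s t : MoritaRing C) : (s + t).a = s.a + t.a := rfl
@[simp] theorem add_n (s t : MoritaRing C) : (s + t).n = s.n + t.n := rfl
@[simp] theorem add_m (s t : MoritaRing C) : (s + t).m = s.m + t.m := rfl
@[simp] theorem add_b (s t : MoritaRing C) : (s + t).b = s.b + t.b := rfl
@[simp] theorem neg_a (s : MoritaRing C) : (-s).a = -s.a := rfl
@[simp] theorem neg_n (s : MoritaRing C) : (-s).n = -s.n := rfl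
@[simp] theorem neg_m (s : MoritaRing C) : (-s).m = -s.m := rfl
@[simp] theorem neg_b (s : MoritaRing C) : (-s).b = -s.b := rfl
@[simp] theorem mul_a (s t : MoritaRing C) : (s * t).a = s.a * t.a + C.ψ (tmul B s.n t.m) := rfl
@[simp] theorem mul_n (s t : MoritaRing C) : (s * t).n = s.a • t.n + op t.b • s.n := rfl
@[simp] theorem mul_m (s t : MoritaRing C) : (s * t).m = op t.a • s.m + s.b • t.m := rfl
@[simp] theorem mul_b (s t : MoritaRing C) : (s * t).b = s.b * t.b + C.φ (tmul A s.m t.n) := rfl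

instance : Ring (MoritaRing C) where
  add_assoc s t r := by ext <;> simp [add_assoc]
  zero_add s := by ext <;> simp
  add_zero s := by ext <;> simp
  add_comm s t := by ext <;> simp [add_comm]
  neg_add_cancel s := by ext <;> simp
  nsmul := nsmulRec
  zsmul := zsmulRec
  zero_mul s := by ext <;> simp [BalancedTensor.zero_tmul]
  mul_zero s := by ext <;> simp [BalancedTensor.tmul_zero]
  one_mul s := by ext <;> simp [BalancedTensor.zero_tmul]
  mul_one s := by ext <;> simp [BalancedTensor.tmul_zero]
  left_distrib s t r := by
    ext <;> simp [mul_add, add_smul, BalancedTensor.tmul_add] <;> abel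
  right_distrib s t r := by
    ext <;> simp [add_mul, add_smul, BalancedTensor.add_tmul] <;> abel
  mul_assoc s t r := by
    ext
    · simp [mul_add, add_mul, mul_assoc, BalancedTensor.add_tmul, BalancedTensor.tmul_add,
        BalancedTensor.smul_tmul, C.ψ_right, ← BalancedTensor.smul_tmul_left]
      abel
    · simp [add_smul, mul_smul, C.smul_φ, smul_comm s.a (op r.b)]
      abel
    · simp [add_smul, mul_smul, C.φ_smul, smul_comm s.b (op r.a)]
      abel
    · simp [mul_add, add_mul, mul_assoc, BalancedTensor.add_tmul, BalancedTensor.tmul_add,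
        BalancedTensor.smul_tmul, C.φ_right, ← BalancedTensor.smul_tmul_left]
      abel

end MoritaRing

/-! ### Modules over Morita rings -/

variable {X Y : Type*} [AddCommGroup X] [Module A X] [AddCommGroup Y] [Module B Y]

/-- The underlying group of the left module `(X, Y)_{f,g}` over the Morita ring: column vectors
`(x; y)` with `x : X` and `y : Y`. -/
@[nolint unusedArguments]
def MoritaModule (_ : MoritaDatum A B M N) (_ : BalancedTensor A M X →ₗ[B] Y)
    (_ : BalancedTensor B N Y →ₗ[A] X) : Type _ := X × Y

namespace MoritaModule

variable (C : MoritaDatum A B M N)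
variable (f : BalancedTensor A M X →ₗ[B] Y) (g : BalancedTensor B N Y →ₗ[A] X)

instance : AddCommGroup (MoritaModule C f g) := inferInstanceAs (AddCommGroup (X × Y))

variable {C f g} in
theorem add_fst (v w : MoritaModule C f g) : (v + w).1 = v.1 + w.1 := rfl

variable {C f g} in
theorem add_snd (v w : MoritaModule C f g) : (v + w).2 = v.2 + w.2 := rfl

theorem zero_fst : (0 : MoritaModule C f g).1 = 0 := rfl

theorem zero_snd : (0 : MoritaModule C f g).2 = 0 := rfl

/-- `(a n; m b) (x; y) = (ax + g(n ⊗ y); f(m ⊗ x) + by)`. -/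
instance : SMul (MoritaRing C) (MoritaModule C f g) :=
  ⟨fun s v => (s.a • v.1 + g (tmul B s.n v.2), f (tmul A s.m v.1) + s.b • v.2)⟩

theorem smul_fst (s : MoritaRing C) (v : MoritaModule C f g) :
    (s • v).1 = s.a • v.1 + g (tmul B s.n v.2) := rfl

theorem smul_snd (s : MoritaRing C) (v : MoritaModule C f g) :
    (s • v).2 = f (tmul A s.m v.1) + s.b • v.2 := rfl

variable {C f g}

theorem comp_eq_zero_left [Subsingleton (BalancedTensor B N M)] (n : N) (m : M) (x : X) :
    g (tmul B n (f (tmul A m x))) = 0 := by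
  let h : BalancedTensor B N M →+ X := BalancedTensor.lift
    (AddMonoidHom.mk' (fun n => AddMonoidHom.mk' (fun m => g (tmul B n (f (tmul A m x))))
      (fun m m' => by simp [BalancedTensor.add_tmul, BalancedTensor.tmul_add]))
      (fun n n' => by ext m; simp [BalancedTensor.add_tmul]))
    (fun n b m => by
      simp [BalancedTensor.smul_tmul, ← BalancedTensor.smul_tmul_left])
  have : h (tmul B n m) = 0 := by rw [Subsingleton.elim (tmul B n m) 0, map_zero]
  exact this

theorem comp_eq_zero_right [Subsingleton (BalancedTensor A M N)] (m : M) (n : N) (y : Y) :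
    f (tmul A m (g (tmul B n y))) = 0 := by
  let h : BalancedTensor A M N →+ Y := BalancedTensor.lift
    (AddMonoidHom.mk' (fun m => AddMonoidHom.mk' (fun n => f (tmul A m (g (tmul B n y))))
      (fun n n' => by simp [BalancedTensor.add_tmul, BalancedTensor.tmul_add]))
      (fun m m' => by ext n; simp [BalancedTensor.add_tmul]))
    (fun m a n => by
      simp [BalancedTensor.smul_tmul, ← BalancedTensor.smul_tmul_left])
  have : h (tmul A m n) = 0 := by rw [Subsingleton.elim (tmul A m n) 0, map_zero]
  exact this

/-- If `M ⊗_A N = 0 = N ⊗_B M`, then every quadruple `(X, Y, f, g)` is a left module over the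
Morita ring. -/
instance [Subsingleton (BalancedTensor A M N)] [Subsingleton (BalancedTensor B N M)] :
    Module (MoritaRing C) (MoritaModule C f g) where
  one_smul v := Prod.ext (by simp [smul_fst, BalancedTensor.zero_tmul])
    (by simp [smul_snd, BalancedTensor.zero_tmul])
  mul_smul s t v := by
    have hψ : C.ψ (tmul B s.n t.m) = 0 := by rw [Subsingleton.elim (tmul B s.n t.m) 0, map_zero]
    have hφ : C.φ (tmul A s.m t.n) = 0 := by rw [Subsingleton.elim (tmul A s.m t.n) 0, map_zero]
    refine Prod.ext ?_ ?_
    · simp [smul_fst, smul_snd, hψ, mul_smul, BalancedTensor.tmul_add, BalancedTensor.add_tmul,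
        comp_eq_zero_left, BalancedTensor.smul_tmul, ← BalancedTensor.smul_tmul_left]
      abel
    · simp [smul_fst, smul_snd, hφ, mul_smul, BalancedTensor.tmul_add, BalancedTensor.add_tmul,
        comp_eq_zero_right, BalancedTensor.smul_tmul, ← BalancedTensor.smul_tmul_left]
      abel
  smul_zero s := Prod.ext (by simp [smul_fst, zero_fst, zero_snd, BalancedTensor.tmul_zero])
    (by simp [smul_snd, zero_fst, zero_snd, BalancedTensor.tmul_zero])
  zero_smul v := Prod.ext (by simp [smul_fst, zero_fst, BalancedTensor.zero_tmul])
    (by simp [smul_snd, zero_snd, BalancedTensor.zero_tmul])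
  smul_add s v w := Prod.ext
    (by simp [smul_fst, add_fst, add_snd, BalancedTensor.tmul_add]; abel)
    (by simp [smul_snd, add_fst, add_snd, BalancedTensor.tmul_add]; abel)
  add_smul s t v := Prod.ext
    (by simp [smul_fst, add_fst, add_smul, BalancedTensor.add_tmul]; abel)
    (by simp [smul_snd, add_snd, add_smul, BalancedTensor.add_tmul]; abel)

end MoritaModule

/-- `(X, Y)_{f,g}` is monic if both structure maps are injective. -/
def IsMonicMoritaModule (f : BalancedTensor A M X →ₗ[B] Y) (g : BalancedTensor B N Y →ₗ[A] X) :
    Prop :=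
  Function.Injective f ∧ Function.Injective g

end Morita

/-! A `Λ`-module is a quadruple `(X, Y, f, g)`. Since `N ⊗_B M = 0 = M ⊗_A N`, the composites of `f`
and `g` (tensored up) vanish, and `N ⊗ Y` is the same as `N ⊗ Coker f`. The finitely generated
projective `Λ`-modules are the retracts of `free P Q = (P ⊕ N ⊗ Q, M ⊗ P ⊕ Q)` with `P`, `Q`
finitely generated projective. For these, `f` and `g` are injective, `Coker g` is a retract of `P`
and `Coker f` is a retract of `Q`.

Gorenstein-projectivity is handled by a coinductive principle (`IsGorensteinProjective.of_class`): a
class belongs to it as soon as each member embeds in a finitely generated projective with cokernel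
in the class, and is covered by one with kernel in the class such that maps from the kernel to
projectives extend. `IsResolvingClass` is the same condition for quadruples.

Necessity. A Gorenstein-projective quadruple embeds in a projective one, so flatness of `M` and `N`
makes `f` and `g` injective. The snake lemma turns short exact sequences of quadruples into short
exact sequences of cokernels, with projective middle term. To extend maps from `Coker g` to a
projective `V`, such a map is first lifted to a morphism into `free V 0` (`exists_hom_free`) and
extended there. Hence the modules `Coker g` satisfy the coinductive principle, and `Coker f` follows
by exchanging the corners.

Sufficiency. A horseshoe argument shows that the monic quadruples with Gorenstein-projective
cokernels form a resolving class. Embeddings `Coker g ⟶ P` and `Coker f ⟶ Q` combine to an embedding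
into `free P Q`, because `Ext¹(Coker g, N ⊗ Q) = 0` allows `N ⊗ Y ⟶ N ⊗ Q` to be extended along `g`.
Covers are obtained by lifting. Maps from a syzygy to a projective `V` extend in two steps
(`IsSES.exists_hom_extension`): first modulo the images of the structure maps of `V`, then inside
these images, which are projective too. -/

namespace BalancedTensor

/-! ### The functor `M ⊗_A -`: exactness and preservation of finitely generated projectives. -/

section Functoriality

variable {A B : Type*} [Ring A] [Ring B]
variable {M : Type*} [AddCommGroup M] [Module B M] [Module Aᵐᵒᵖ M] [SMulCommClass B Aᵐᵒᵖ M]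
variable {X X' X'' : Type*} [AddCommGroup X] [Module A X] [AddCommGroup X'] [Module A X']
  [AddCommGroup X''] [Module A X'']
variable {G : Type*} [AddCommGroup G] [Module B G]

theorem hom_ext {h k : BalancedTensor A M X →ₗ[B] G}
    (H : ∀ m x, h (tmul A m x) = k (tmul A m x)) : h = k := by
  ext t
  induction t using induction_on with
  | zero => simp
  | tmul m x => exact H m x
  | add s t hs ht => simp [hs, ht]

/-- The linear map on `M ⊗_A X` induced by a balanced biadditive map which is linear in the first
variable. -/
def liftLinear (h : M →+ X →+ G) (hh : ∀ m (a : A) x, h (op a • m) x = h m (a • x))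
    (hs : ∀ (b : B) m x, h (b • m) x = b • h m x) : BalancedTensor A M X →ₗ[B] G where
  __ := lift h hh
  map_smul' b t := by
    simp only [ZeroHom.toFun_eq_coe, AddMonoidHom.toZeroHom_coe, RingHom.id_apply]
    induction t using induction_on with
    | zero => simp
    | tmul m x => rw [smul_tmul_left]; simp [hs]
    | add s t hs ht => simp [hs, ht]

@[simp]
theorem liftLinear_tmul (h : M →+ X →+ G) (hh : ∀ m (a : A) x, h (op a • m) x = h m (a • x))
    (hs : ∀ (b : B) m x, h (b • m) x = b • h m x) (m : M) (x : X) :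
    liftLinear h hh hs (tmul A m x) = h m x := rfl

variable (B M) in
/-- The map `M ⊗_A X → M ⊗_A X'` induced by `X → X'`. -/
def map (h : X →ₗ[A] X') : BalancedTensor A M X →ₗ[B] BalancedTensor A M X' :=
  liftLinear
    (AddMonoidHom.mk' (fun m => AddMonoidHom.mk' (fun x => tmul A m (h x))
      (fun x x' => by simp [tmul_add])) (fun m m' => by ext x; simp [add_tmul]))
    (fun m a x => by simp [smul_tmul])
    (fun b m x => by simp [smul_tmul_left])

@[simp]
theorem map_tmul (h : X →ₗ[A] X') (m : M) (x : X) :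
    map B M h (tmul A m x) = tmul A m (h x) := rfl

theorem map_map (h : X →ₗ[A] X') (k : X' →ₗ[A] X'') (t : BalancedTensor A M X) :
    map B M k (map B M h t) = map B M (k ∘ₗ h) t := by
  induction t using induction_on with
  | zero => simp
  | tmul m x => simp
  | add s t hs ht => simp [hs, ht]

@[simp]
theorem map_id (t : BalancedTensor A M X) : map B M (LinearMap.id : X →ₗ[A] X) t = t := by
  induction t using induction_on with
  | zero => simp
  | tmul m x => simp
  | add s t hs ht => simp [hs, ht]

theorem map_surjective {h : X →ₗ[A] X'} (hh : Function.Surjective h) :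
    Function.Surjective (map B M h) := by
  intro t
  induction t using induction_on with
  | zero => exact ⟨0, map_zero _⟩
  | tmul m x => obtain ⟨x, rfl⟩ := hh x; exact ⟨tmul A m x, rfl⟩
  | add s t hs ht =>
    obtain ⟨s, rfl⟩ := hs
    obtain ⟨t, rfl⟩ := ht
    exact ⟨s + t, map_add _ _ _⟩

theorem tmul_sum {ι : Type*} (s : Finset ι) (m : M) (x : ι → X) :
    tmul A m (∑ j ∈ s, x j) = ∑ j ∈ s, tmul A m (x j) :=
  map_sum (AddMonoidHom.mk' (fun x => tmul A m x) (fun x x' => tmul_add m x x')) x s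

theorem sum_tmul {ι : Type*} (s : Finset ι) (m : ι → M) (x : X) :
    tmul A (∑ j ∈ s, m j) x = ∑ j ∈ s, tmul A (m j) x :=
  map_sum (AddMonoidHom.mk' (fun m => tmul A m x) (fun m m' => add_tmul m m' x)) m s

/-- The map `M ⊗_A X → X` induced by a linear functional on `M`. -/
def coord (c : M →ₗ[Aᵐᵒᵖ] Aᵐᵒᵖ) : BalancedTensor A M X →+ X :=
  lift (AddMonoidHom.mk' (fun m => AddMonoidHom.mk' (fun x => (c m).unop • x)
    (fun x x' => by simp)) (fun m m' => by ext x; simp [add_smul]))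
    (fun m a x => by simp [mul_smul])

@[simp]
theorem coord_tmul (c : M →ₗ[Aᵐᵒᵖ] Aᵐᵒᵖ) (m : M) (x : X) :
    coord c (tmul A m x) = (c m).unop • x := rfl

theorem coord_map (c : M →ₗ[Aᵐᵒᵖ] Aᵐᵒᵖ) (h : X →ₗ[A] X') (t : BalancedTensor A M X) :
    coord c (map B M h t) = h (coord c t) := by
  induction t using induction_on with
  | zero => simp
  | tmul m x => simp
  | add s t hs ht => simp only [map_add, hs, ht]

/-- If `M` is finitely generated projective over `A`, then `M ⊗_A -` is exact. -/
theorem exists_of_map_eq_zero [Module.Finite Aᵐᵒᵖ M] [Module.Projective Aᵐᵒᵖ M] {h : X →ₗ[A] X'}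
    {t : BalancedTensor A M X} (ht : map B M h t = 0) :
    ∃ (n : ℕ) (e : Fin n → M) (x : Fin n → X), (∀ j, h (x j) = 0) ∧
      t = ∑ j, tmul A (e j) (x j) := by
  obtain ⟨n, π, s, -, -, hπ⟩ := Module.Finite.exists_comp_eq_id_of_projective Aᵐᵒᵖ M
  let c (j : Fin n) : M →ₗ[Aᵐᵒᵖ] Aᵐᵒᵖ := LinearMap.proj j ∘ₗ s
  -- Dual basis: `t = ∑ e_j ⊗ c_j(t)` with `e_j = π (Pi.single j 1)`. The contractions `c_j` commute
  -- with `h`, so the `c_j(t)` lie in its kernel.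
  refine ⟨n, fun j => π (Pi.single j 1), fun j => coord (c j) t,
    fun j => by rw [← coord_map (B := B), ht, map_zero], ?_⟩
  -- The dual basis expansion holds for every `t`; the induction must not carry the vanishing
  -- assumption.
  clear ht
  induction t using induction_on with
  | zero => simp [tmul_zero]
  | tmul m x =>
    have h1 : ∀ j, tmul A (π (Pi.single j 1)) (coord (c j) (tmul A m x)) =
        tmul A (s m j • π (Pi.single j 1)) x := fun j => (smul_tmul _ (s m j).unop _).symm
    simp only [h1]
    rw [← sum_tmul]
    congr 1
    have h2 : m = π (s m) := (LinearMap.congr_fun hπ m).symm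
    conv_lhs => rw [h2, ← Finset.univ_sum_single (s m)]
    rw [map_sum]
    refine Finset.sum_congr rfl fun j _ => ?_
    rw [← map_smul]
    congr 1
    ext i
    by_cases hij : i = j
    · subst hij; simp
    · simp [hij]
  | add s t hs ht =>
    conv_lhs => rw [hs, ht]
    simp [tmul_add, Finset.sum_add_distrib]

theorem map_injective [Module.Finite Aᵐᵒᵖ M] [Module.Projective Aᵐᵒᵖ M] {h : X →ₗ[A] X'}
    (hh : Function.Injective h) : Function.Injective (map B M h) := by
  rw [injective_iff_map_eq_zero]
  intro t ht
  obtain ⟨n, e, x, hx, rfl⟩ := exists_of_map_eq_zero ht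
  refine Finset.sum_eq_zero fun j _ => ?_
  rw [(injective_iff_map_eq_zero h).1 hh _ (hx j), tmul_zero]

/-- The tensor product of a bimodule which is finitely generated projective on the left with a
finitely generated projective module is a retract of a finitely generated projective module. -/
theorem exists_retract [Module.Finite A X] [Module.Projective A X] :
    ∃ (n : ℕ) (i : BalancedTensor A M X →ₗ[B] (Fin n → M))
      (p : (Fin n → M) →ₗ[B] BalancedTensor A M X), p ∘ₗ i = LinearMap.id := by
  obtain ⟨n, π, s, -, -, hπ⟩ := Module.Finite.exists_comp_eq_id_of_projective A X
  -- With `M ⊗ Aⁿ` identified with `Mⁿ`, the two maps are `M ⊗ s` and `M ⊗ π`.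
  refine ⟨n, liftLinear (AddMonoidHom.mk' (fun m => AddMonoidHom.mk'
      (fun x j => op (s x j) • m) (fun x x' => by ext j; simp [add_smul]))
      (fun m m' => by ext x j; simp))
      (fun m a x => by ext j; simp [mul_smul])
      (fun b m x => by ext j; simp [smul_comm]),
    { toFun := fun v => ∑ j, tmul A (v j) (π (Pi.single j 1))
      map_add' := fun v w => by simp [add_tmul, Finset.sum_add_distrib]
      map_smul' := fun b v => by simp [← smul_tmul_left, Finset.smul_sum] }, hom_ext ?_⟩
  intro m x
  change ∑ j, tmul A (op (s x j) • m) (π (Pi.single j 1)) = tmul A m x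
  simp only [smul_tmul]
  rw [← tmul_sum]
  congr 1
  have h2 : x = π (s x) := (LinearMap.congr_fun hπ x).symm
  conv_rhs => rw [h2, ← Finset.univ_sum_single (s x)]
  rw [map_sum]
  refine Finset.sum_congr rfl fun j _ => ?_
  rw [← map_smul]
  congr 1
  ext i
  by_cases hij : i = j
  · subst hij; simp
  · simp [hij]

instance [Module.Finite A X] [Module.Projective A X] [Module.Projective B M] :
    Module.Projective B (BalancedTensor A M X) := by
  obtain ⟨n, i, p, h⟩ := exists_retract (A := A) (B := B) (M := M) (X := X)
  have := Module.Projective.of_equiv'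
    (DFinsupp.linearEquivFunOnFintype (R := B) (M := fun _ : Fin n => M))
  exact Module.Projective.of_split i p h

instance [Module.Finite A X] [Module.Projective A X] [Module.Finite B M] :
    Module.Finite B (BalancedTensor A M X) := by
  obtain ⟨n, i, p, h⟩ := exists_retract (A := A) (B := B) (M := M) (X := X)
  exact Module.Finite.of_surjective p fun t => ⟨i t, LinearMap.congr_fun h t⟩

end Functoriality

/-! ### Consequences of `N ⊗_B M = 0`. -/

section Vanishing

variable {A B : Type*} [Ring A] [Ring B]
variable {M : Type*} [AddCommGroup M] [Module B M] [Module Aᵐᵒᵖ M] [SMulCommClass B Aᵐᵒᵖ M]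
variable {N : Type*} [AddCommGroup N] [Module Bᵐᵒᵖ N]
variable {X : Type*} [AddCommGroup X] [Module A X] {Y : Type*} [AddCommGroup Y] [Module B Y]

/-- If `N ⊗_B M = 0`, then `N ⊗_B -` kills every map out of `M ⊗_A X`. -/
theorem tmul_apply_eq_zero [Subsingleton (BalancedTensor B N M)]
    (f : BalancedTensor A M X →ₗ[B] Y) (n : N) (t : BalancedTensor A M X) :
    tmul B n (f t) = 0 := by
  induction t using induction_on with
  | zero => simp [tmul_zero]
  | tmul m x =>
    let h : BalancedTensor B N M →+ BalancedTensor B N Y := lift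
      (AddMonoidHom.mk' (fun n => AddMonoidHom.mk' (fun m => tmul B n (f (tmul A m x)))
        (fun m m' => by simp [add_tmul, tmul_add])) (fun n n' => by ext m; simp [add_tmul]))
      (fun n b m => by simp [smul_tmul, ← smul_tmul_left])
    have : h (tmul B n m) = 0 := by rw [Subsingleton.elim (tmul B n m) 0, map_zero]
    exact this
  | add s t hs ht => rw [map_add, tmul_add, hs, ht, add_zero]

variable [Module A N] [SMulCommClass A Bᵐᵒᵖ N]

theorem map_apply_eq_zero [Subsingleton (BalancedTensor B N M)]
    (f : BalancedTensor A M X →ₗ[B] Y) (t : BalancedTensor B N (BalancedTensor A M X)) :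
    map A N f t = 0 := by
  induction t using induction_on with
  | zero => simp
  | tmul n s => exact tmul_apply_eq_zero f n s
  | add s t hs ht => rw [map_add, hs, ht, add_zero]

theorem subsingleton_tensor [Subsingleton (BalancedTensor B N M)] :
    Subsingleton (BalancedTensor B N (BalancedTensor A M X)) :=
  subsingleton_of_forall_eq 0 fun t => by
    simpa using map_apply_eq_zero (A := A) (N := N)
      (LinearMap.id : BalancedTensor A M X →ₗ[B] BalancedTensor A M X) t

end Vanishing

end BalancedTensor

/-! ### Short exact sequences of modules. -/

section ShortExact

variable {S : Type*} [Ring S]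
variable {K P G : Type*} [AddCommGroup K] [Module S K] [AddCommGroup P] [Module S P]
  [AddCommGroup G] [Module S G]

/-- A short exact sequence `0 ⟶ K ⟶ P ⟶ G ⟶ 0`. -/
structure IsShortExact (i : K →ₗ[S] P) (p : P →ₗ[S] G) : Prop where
  injective : Function.Injective i
  exact : Function.Exact i p
  surjective : Function.Surjective p

theorem IsShortExact.comp_equiv {G' : Type*} [AddCommGroup G'] [Module S G']
    {i : K →ₗ[S] P} {p : P →ₗ[S] G} (h : IsShortExact i p) (e : G ≃ₗ[S] G') :
    IsShortExact i (e.toLinearMap ∘ₗ p) where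
  injective := h.injective
  exact x := by simpa using h.exact x
  surjective := e.surjective.comp h.surjective

theorem IsShortExact.equiv_comp {K' : Type*} [AddCommGroup K'] [Module S K']
    {i : K →ₗ[S] P} {p : P →ₗ[S] G} (h : IsShortExact i p) (e : K' ≃ₗ[S] K) :
    IsShortExact (i ∘ₗ e.toLinearMap) p where
  injective := h.injective.comp e.injective
  exact x := by
    rw [h.exact x]
    exact ⟨fun ⟨k, hk⟩ => ⟨e.symm k, by simp [hk]⟩, fun ⟨k, hk⟩ => ⟨e k, hk⟩⟩
  surjective := h.surjective

theorem LinearMap.exists_comp_eq_of_surjective {p : P →ₗ[S] G} (hp : Function.Surjective p)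
    (h : P →ₗ[S] K) (hh : ∀ x, p x = 0 → h x = 0) : ∃ k : G →ₗ[S] K, k ∘ₗ p = h := by
  refine ⟨(LinearMap.ker p).liftQ h (fun x hx => hh x hx) ∘ₗ
    (p.quotKerEquivOfSurjective hp).symm.toLinearMap, ?_⟩
  ext x
  have : (p.quotKerEquivOfSurjective hp).symm (p x) = Submodule.Quotient.mk x := by
    rw [LinearEquiv.symm_apply_eq]; rfl
  rw [LinearMap.comp_apply, LinearMap.comp_apply, LinearEquiv.coe_coe, this]
  rfl

/-- The cokernel of a short exact sequence is determined up to isomorphism. -/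
theorem IsShortExact.nonempty_equiv {G' : Type*} [AddCommGroup G'] [Module S G']
    {i : K →ₗ[S] P} {p : P →ₗ[S] G} {p' : P →ₗ[S] G'} (h : IsShortExact i p)
    (h' : IsShortExact i p') : Nonempty (G ≃ₗ[S] G') := by
  obtain ⟨k, hk⟩ := LinearMap.exists_comp_eq_of_surjective h.surjective p'
    (fun x hx => (h'.exact x).2 ((h.exact x).1 hx))
  have hk' (x) : k (p x) = p' x := LinearMap.congr_fun hk x
  refine ⟨LinearEquiv.ofBijective k ⟨?_, ?_⟩⟩
  · rw [injective_iff_map_eq_zero]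
    intro y hy
    obtain ⟨x, rfl⟩ := h.surjective y
    exact (h.exact x).2 ((h'.exact x).1 (by rw [← hk', hy]))
  · intro y
    obtain ⟨x, rfl⟩ := h'.surjective y
    exact ⟨p x, hk' x⟩

/-- The kernel of a short exact sequence is determined up to isomorphism. -/
theorem IsShortExact.nonempty_equiv_left {K' : Type*} [AddCommGroup K'] [Module S K']
    {i : K →ₗ[S] P} {i' : K' →ₗ[S] P} {p : P →ₗ[S] G} (h : IsShortExact i p)
    (h' : IsShortExact i' p) : Nonempty (K ≃ₗ[S] K') := by
  have e : LinearMap.range i = LinearMap.range i' := by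
    ext x
    rw [LinearMap.mem_range, LinearMap.mem_range]
    exact (h.exact x).symm.trans (h'.exact x)
  exact ⟨(LinearEquiv.ofInjective i h.injective).trans
    ((LinearEquiv.ofEq _ _ e).trans (LinearEquiv.ofInjective i' h'.injective).symm)⟩

end ShortExact

/-! ### Vanishing of `Ext¹` into finitely generated projectives, without derived functors. -/

section ExtVanishing

variable (S : Type u) [Ring S]

/-- Every map from `K` to a finitely generated projective module extends along `i : K ⟶ P`. -/
def ExtendsToProjectives {K P : Type u} [AddCommGroup K] [Module S K] [AddCommGroup P] [Module S P]
    (i : K →ₗ[S] P) : Prop :=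
  ∀ (Q : Type u) [AddCommGroup Q] [Module S Q] [Module.Finite S Q] [Module.Projective S Q]
    (h : K →ₗ[S] Q), ∃ k : P →ₗ[S] Q, k ∘ₗ i = h

/-- `Ext¹(G, Q) = 0` for all finitely generated projective modules `Q`. -/
def ExtVanishing (G : Type u) [AddCommGroup G] [Module S G] : Prop :=
  ∀ (K P : Type u) [AddCommGroup K] [Module S K] [AddCommGroup P] [Module S P]
    (i : K →ₗ[S] P) (p : P →ₗ[S] G), IsShortExact i p → ExtendsToProjectives S i

variable {S}

/-- One projective presentation controls all extensions `0 ⟶ K' ⟶ L ⟶ G ⟶ 0`. Lifting `p` gives `s :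
P ⟶ L` and `r : K ⟶ K'`, and `L` is the pushout of `r` and `i`. A map `φ` on `K'` and an extension
`e` of `φ ∘ r` to `P` therefore glue to a map on `L`. -/
theorem ExtVanishing.of_projective_presentation {K P G : Type u} [AddCommGroup K] [Module S K]
    [AddCommGroup P] [Module S P] [AddCommGroup G] [Module S G] [Module.Projective S P]
    {i : K →ₗ[S] P} {p : P →ₗ[S] G} (h : IsShortExact i p) (hi : ExtendsToProjectives S i) :
    ExtVanishing S G := by
  intro K' L _ _ _ _ j q hjq Q _ _ _ _ φ
  obtain ⟨s, hs⟩ := Module.projective_lifting_property q p hjq.surjective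
  have hs' (x) : q (s x) = p x := LinearMap.congr_fun hs x
  have hpi (x) : p (i x) = 0 := (h.exact _).2 ⟨x, rfl⟩
  have hr (x : K) : s (i x) ∈ LinearMap.range j := (hjq.exact _).1 (by rw [hs', hpi])
  let r : K →ₗ[S] K' := (LinearEquiv.ofInjective j hjq.injective).symm.toLinearMap ∘ₗ
    (s ∘ₗ i).codRestrict (LinearMap.range j) hr
  have hjr (x) : j (r x) = s (i x) := by
    have := (LinearEquiv.ofInjective j hjq.injective).apply_symm_apply ⟨s (i x), hr x⟩
    exact congrArg Subtype.val this
  obtain ⟨e, he⟩ := hi Q (φ ∘ₗ r)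
  have he' (x) : e (i x) = φ (r x) := LinearMap.congr_fun he x
  have hsurj : Function.Surjective (j.coprod s) := by
    intro y
    obtain ⟨x, hx⟩ := h.surjective (q y)
    obtain ⟨k, hk⟩ := (hjq.exact (y - s x)).1 (by rw [map_sub, hs', hx, sub_self])
    exact ⟨(k, x), by simp [hk]⟩
  -- The kernel of `K' × P ⟶ L` consists of the pairs `(-r w, i w)`, on which `φ` and `e` cancel.
  obtain ⟨k, hk⟩ := LinearMap.exists_comp_eq_of_surjective hsurj (φ.coprod e) (by
    rintro ⟨a, x⟩ hax
    simp only [LinearMap.coprod_apply] at hax ⊢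
    have hq : q (j a) = 0 := (hjq.exact _).2 ⟨a, rfl⟩
    obtain ⟨w, rfl⟩ := (h.exact x).1 (by
      have := congrArg q hax
      simpa [hq, hs'] using this)
    rw [← hjr, ← map_add] at hax
    have := (injective_iff_map_eq_zero j).1 hjq.injective _ hax
    rw [he', ← map_add, this, map_zero])
  refine ⟨k, ?_⟩
  ext x
  simpa using LinearMap.congr_fun hk (x, 0)

end ExtVanishing

/-! ### Shifting complete resolutions and cutting them into short exact sequences. -/

namespace CompleteProjectiveResolution

variable {S : Type u} [Ring S] (T : CompleteProjectiveResolution S)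

/-- The identification of the terms of a complex at equal indices. -/
def castEquiv {i j : ℤ} (h : i = j) : T.P i ≃ₗ[S] T.P j := by
  subst h; exact LinearEquiv.refl S _

/-- With variable indices, `subst` turns the casts into identities. `shift` needs this because `i +
c + 1` and `i + 1 + c` agree only propositionally. -/
theorem exact_cast {j k l : ℤ} (h : j + 1 = k) (h' : k + 1 = l) :
    Function.Exact ((T.castEquiv h).toLinearMap ∘ₗ T.d j)
      ((T.castEquiv h').toLinearMap ∘ₗ T.d k) := by
  subst h; subst h'; exact T.exact j

theorem hom_exact_cast (Q : Type u) [AddCommGroup Q] [Module S Q] [Module.Finite S Q]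
    [Module.Projective S Q] {j k l : ℤ} (h : j + 1 = k) (h' : k + 1 = l) :
    Function.Exact (fun φ : T.P l →ₗ[S] Q => φ ∘ₗ ((T.castEquiv h').toLinearMap ∘ₗ T.d k))
      (fun φ : T.P k →ₗ[S] Q => φ ∘ₗ ((T.castEquiv h).toLinearMap ∘ₗ T.d j)) := by
  subst h; subst h'; exact T.hom_exact Q j

theorem ker_cast {i j k : ℤ} (h : i = j) (h' : i + 1 = k) :
    Nonempty (LinearMap.ker (T.d j) ≃ₗ[S]
      LinearMap.ker ((T.castEquiv h').toLinearMap ∘ₗ T.d i)) := by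
  subst h; subst h'; exact ⟨LinearEquiv.refl S _⟩

/-- The complex shifted by `c`. -/
def shift (c : ℤ) : CompleteProjectiveResolution S where
  P i := T.P (i + c)
  d i := (T.castEquiv (by ring : i + c + 1 = i + 1 + c)).toLinearMap ∘ₗ T.d (i + c)
  exact i := T.exact_cast _ _
  hom_exact Q _ _ _ _ i := T.hom_exact_cast Q _ _

theorem isShortExact (i : ℤ) :
    IsShortExact (LinearMap.ker (T.d i)).subtype
      ((T.d i).codRestrict (LinearMap.ker (T.d (i + 1)))
        (fun x => (T.exact i _).2 ⟨x, rfl⟩)) where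
  injective := Subtype.val_injective
  exact x := by
    simp only [Submodule.coe_subtype, Subtype.range_coe_subtype, Set.mem_ofPred_eq,
      LinearMap.mem_ker]
    exact Subtype.ext_iff
  surjective := by
    rintro ⟨y, hy⟩
    obtain ⟨x, rfl⟩ := (T.exact i y).1 hy
    exact ⟨x, rfl⟩

/-- A map on this kernel, pulled back along the surjection from `P (i + 1)`, is a cocycle of the
complex `Hom(P, Q)`; exactness of that complex supplies the extension. -/
theorem extendsToProjectives (i : ℤ) :
    ExtendsToProjectives S (LinearMap.ker (T.d (i + 1 + 1))).subtype := by
  intro Q _ _ _ _ h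
  let q := (T.d (i + 1)).codRestrict (LinearMap.ker (T.d (i + 1 + 1)))
        (fun x => (T.exact (i + 1) _).2 ⟨x, rfl⟩)
  obtain ⟨k, hk⟩ := (T.hom_exact Q i (h ∘ₗ q)).1 (by
    ext x
    have : q (T.d i x) = 0 := Subtype.ext ((T.exact i _).2 ⟨x, rfl⟩)
    simp [this])
  refine ⟨k, ?_⟩
  ext y
  obtain ⟨x, rfl⟩ := (T.isShortExact (i + 1)).surjective y
  exact LinearMap.congr_fun hk x

end CompleteProjectiveResolution

/-! ### Gorenstein-projective modules through their syzygies and cosyzygies. -/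

namespace IsGorensteinProjective

variable {S : Type u} [Ring S]

theorem of_equiv {G G' : Type*} [AddCommGroup G] [Module S G] [AddCommGroup G'] [Module S G']
    (h : IsGorensteinProjective S G) (e : G' ≃ₗ[S] G) : IsGorensteinProjective S G' := by
  obtain ⟨T, ⟨e'⟩⟩ := h
  exact ⟨T, ⟨e.trans e'⟩⟩

theorem ker (T : CompleteProjectiveResolution S) (i : ℤ) :
    IsGorensteinProjective S (LinearMap.ker (T.d i)) :=
  ⟨T.shift i, T.ker_cast (zero_add i) _⟩

theorem exists_equiv_ker {G : Type*} [AddCommGroup G] [Module S G]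
    (h : IsGorensteinProjective S G) (i : ℤ) :
    ∃ T : CompleteProjectiveResolution S, Nonempty (G ≃ₗ[S] LinearMap.ker (T.d i)) := by
  obtain ⟨T, ⟨e⟩⟩ := h
  obtain ⟨e'⟩ := T.ker_cast (add_neg_cancel i) (by ring : i + -i + 1 = i + 1 + -i)
  exact ⟨T.shift (-i), ⟨e.trans e'⟩⟩

theorem exists_right {G : Type*} [AddCommGroup G] [Module S G]
    (h : IsGorensteinProjective S G) : ∃ (P G' : Type u) (_ : AddCommGroup P) (_ : Module S P)
      (_ : AddCommGroup G') (_ : Module S G') (i : G →ₗ[S] P) (p : P →ₗ[S] G'),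
      Module.Finite S P ∧ Module.Projective S P ∧ IsShortExact i p ∧
      IsGorensteinProjective S G' := by
  obtain ⟨T, ⟨e⟩⟩ := h
  exact ⟨_, _, _, _, _, _, _, _, inferInstance, inferInstance, (T.isShortExact 0).equiv_comp e,
    ker T _⟩

theorem exists_left {G : Type*} [AddCommGroup G] [Module S G]
    (h : IsGorensteinProjective S G) : ∃ (K P : Type u) (_ : AddCommGroup K) (_ : Module S K)
      (_ : AddCommGroup P) (_ : Module S P) (i : K →ₗ[S] P) (p : P →ₗ[S] G),
      Module.Finite S P ∧ Module.Projective S P ∧ IsShortExact i p ∧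
      IsGorensteinProjective S K ∧ ExtendsToProjectives S i := by
  -- The index is kept in this form so that the syzygy is literally the kernel of `T.d (0 + 1 + 1)`
  -- treated by `extendsToProjectives 0`.
  obtain ⟨T, ⟨e⟩⟩ := h.exists_equiv_ker (0 + 1 + 1 + 1)
  exact ⟨_, _, _, _, _, _, _, _, inferInstance, inferInstance,
    (T.isShortExact (0 + 1 + 1)).comp_equiv e.symm, ker T _, T.extendsToProjectives 0⟩

theorem extVanishing {G : Type u} [AddCommGroup G] [Module S G]
    (h : IsGorensteinProjective S G) : ExtVanishing S G := by
  obtain ⟨K, P, _, _, _, _, i, p, _, _, hip, -, hi⟩ := h.exists_left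
  exact ExtVanishing.of_projective_presentation hip hi

end IsGorensteinProjective

/-- Iterates chosen successors to the right and chosen predecessors to the left. -/
theorem exists_int_seq {α : Type*} {r : α → α → Prop} (hr : ∀ a, ∃ b, r a b)
    (hl : ∀ a, ∃ b, r b a) (a : α) : ∃ Z : ℤ → α, Z 0 = a ∧ ∀ i, r (Z i) (Z (i + 1)) := by
  choose R hR using hr
  choose L hL using hl
  let Z : ℤ → α := fun
    | Int.ofNat n => R^[n] a
    | Int.negSucc n => L^[n + 1] a
  refine ⟨Z, rfl, fun i => ?_⟩
  match i with
  | Int.ofNat n =>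
    change r (R^[n] a) (R^[n + 1] a)
    rw [Function.iterate_succ_apply']
    exact hR _
  | Int.negSucc 0 => exact hL a
  | Int.negSucc (n + 1) =>
    change r (L^[n + 1 + 1] a) (L^[n + 1] a)
    rw [Function.iterate_succ_apply' L (n + 1)]
    exact hL _

/-- The Gorenstein-projective modules are the largest class of modules which is closed under
suitable syzygies and cosyzygies. -/
theorem IsGorensteinProjective.of_class {S : Type u} [Ring S]
    (𝒳 : ∀ (G : Type u) [AddCommGroup G] [Module S G], Prop)
    (right : ∀ (G : Type u) [AddCommGroup G] [Module S G], 𝒳 G →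
      ∃ (P G' : Type u) (_ : AddCommGroup P) (_ : Module S P)
      (_ : AddCommGroup G') (_ : Module S G') (i : G →ₗ[S] P) (p : P →ₗ[S] G'),
      Module.Finite S P ∧ Module.Projective S P ∧ IsShortExact i p ∧ 𝒳 G')
    (left : ∀ (G : Type u) [AddCommGroup G] [Module S G], 𝒳 G →
      ∃ (K P : Type u) (_ : AddCommGroup K) (_ : Module S K)
      (_ : AddCommGroup P) (_ : Module S P) (i : K →ₗ[S] P) (p : P →ₗ[S] G),
      Module.Finite S P ∧ Module.Projective S P ∧ IsShortExact i p ∧ 𝒳 K ∧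
      ExtendsToProjectives S i)
    (G : Type u) [AddCommGroup G] [Module S G] (hG : 𝒳 G) : IsGorensteinProjective S G := by
  -- Every member of the class has vanishing `Ext¹`, so the extension property is available for the
  -- cosyzygy sequences as well, although `right` does not ask for it.
  have ext (G : Type u) [AddCommGroup G] [Module S G] (hG : 𝒳 G) : ExtVanishing S G := by
    obtain ⟨K, P, _, _, _, _, i, p, _, _, hip, -, hi⟩ := left G hG
    exact ExtVanishing.of_projective_presentation hip hi
  let r (K G : {G : ModuleCat.{u} S // 𝒳 G}) : Prop :=
    ∃ (P : ModuleCat.{u} S) (i : K.1 →ₗ[S] P) (p : P →ₗ[S] G.1),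
      Module.Finite S P ∧ Module.Projective S P ∧ IsShortExact i p
  obtain ⟨Z, hZ0, hZ⟩ := exists_int_seq (r := r)
    (fun a => by
      obtain ⟨P, G', _, _, _, _, i, p, h1, h2, h3, h4⟩ := right a.1 a.2
      exact ⟨⟨ModuleCat.of S G', h4⟩, ModuleCat.of S P, i, p, h1, h2, h3⟩)
    (fun a => by
      obtain ⟨K, P, _, _, _, _, i, p, h1, h2, h3, h4, -⟩ := left a.1 a.2
      exact ⟨⟨ModuleCat.of S K, h4⟩, ModuleCat.of S P, i, p, h1, h2, h3⟩)
    ⟨ModuleCat.of S G, hG⟩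
  choose P ι p hfin hproj hses using hZ
  have hker (i) (x : P i) : ι (i + 1) (p i x) = 0 ↔ p i x = 0 :=
    map_eq_zero_iff _ (hses (i + 1)).injective
  -- The sequences `0 ⟶ Z i ⟶ P i ⟶ Z (i + 1) ⟶ 0` are spliced.
  let T : CompleteProjectiveResolution S :=
    { P := fun i => P i
      d := fun i => ι (i + 1) ∘ₗ p i
      exact := fun i x => by
        simp only [LinearMap.comp_apply]
        rw [hker, (hses (i + 1)).exact x]
        constructor
        · rintro ⟨z, rfl⟩
          obtain ⟨w, rfl⟩ := (hses i).surjective z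
          exact ⟨w, rfl⟩
        · rintro ⟨w, rfl⟩
          exact ⟨_, rfl⟩
      hom_exact := fun Q _ _ _ _ i h => by
        constructor
        · intro hh
          -- A cocycle factors through `Z (i + 1 + 1)`; it then extends to the next term because
          -- `Ext¹(Z (i + 1 + 1 + 1), Q) = 0`.
          obtain ⟨k, hk⟩ := LinearMap.exists_comp_eq_of_surjective (hses (i + 1)).surjective h (by
            intro x hx
            obtain ⟨z, rfl⟩ := ((hses (i + 1)).exact x).1 hx
            obtain ⟨w, rfl⟩ := (hses i).surjective z
            exact LinearMap.congr_fun hh w)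
          obtain ⟨l, hl⟩ := ext _ (Z (i + 1 + 1 + 1)).2 _ _ _ _ (hses (i + 1 + 1)) Q k
          exact ⟨l, by simp only [← LinearMap.comp_assoc, hl, hk]⟩
        · rintro ⟨k, rfl⟩
          ext x
          have : p (i + 1) (ι (i + 1) (p i x)) = 0 := ((hses (i + 1)).exact _).2 ⟨_, rfl⟩
          simp [this] }
  refine ⟨T, ?_⟩
  have e : (Z 0).1 ≃ₗ[S] LinearMap.ker (T.d 0) :=
    (LinearEquiv.ofInjective (ι 0) (hses 0).injective).trans (LinearEquiv.ofEq _ _ (by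
      ext x
      rw [LinearMap.mem_range, LinearMap.mem_ker]
      exact ((hses 0).exact x).symm.trans (hker 0 x).symm))
  rw [hZ0] at e
  exact ⟨e⟩

set_option linter.unusedSectionVars false

/-! ### Modules over a Morita ring with zero structure maps as quadruples -/

section MoritaTuple

open BalancedTensor

/-- The data `(X, Y, f, g)` of a module over a Morita ring. -/
structure MoritaTuple (A B M N : Type u) [Ring A] [Ring B]
    [AddCommGroup M] [Module B M] [Module Aᵐᵒᵖ M] [SMulCommClass B Aᵐᵒᵖ M]
    [AddCommGroup N] [Module A N] [Module Bᵐᵒᵖ N] [SMulCommClass A Bᵐᵒᵖ N] where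
  X : Type u
  Y : Type u
  [addCommGroupX : AddCommGroup X]
  [moduleX : Module A X]
  [addCommGroupY : AddCommGroup Y]
  [moduleY : Module B Y]
  f : BalancedTensor A M X →ₗ[B] Y
  g : BalancedTensor B N Y →ₗ[A] X

theorem BalancedTensor.tmul_sub {A M X : Type*} [Ring A] [AddCommGroup M] [Module Aᵐᵒᵖ M]
    [AddCommGroup X] [Module A X] (m : M) (x x' : X) :
    tmul A m (x - x') = tmul A m x - tmul A m x' :=
  map_sub (AddMonoidHom.mk' (fun x => tmul A m x) (fun x x' => tmul_add m x x')) x x'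

namespace MoritaTuple

attribute [instance] addCommGroupX moduleX addCommGroupY moduleY

variable {A B M N : Type u} [Ring A] [Ring B]
variable [AddCommGroup M] [Module B M] [Module Aᵐᵒᵖ M] [SMulCommClass B Aᵐᵒᵖ M]
variable [AddCommGroup N] [Module A N] [Module Bᵐᵒᵖ N] [SMulCommClass A Bᵐᵒᵖ N]

/-- The same data with the roles of the two corners exchanged. -/
abbrev swap (G : MoritaTuple A B M N) : MoritaTuple B A N M where
  X := G.Y
  Y := G.X
  f := G.g
  g := G.f

/-- Morphisms of quadruples. -/
structure Hom (G H : MoritaTuple A B M N) where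
  α : G.X →ₗ[A] H.X
  β : G.Y →ₗ[B] H.Y
  comm_f : ∀ m x, β (G.f (tmul A m x)) = H.f (tmul A m (α x))
  comm_g : ∀ n y, α (G.g (tmul B n y)) = H.g (tmul B n (β y))

/-- The cokernel of the structure map `g`. -/
abbrev Cok (G : MoritaTuple A B M N) : Type u := G.X ⧸ LinearMap.range G.g

theorem mk_g (G : MoritaTuple A B M N) (t : BalancedTensor B N G.Y) :
    (Submodule.Quotient.mk (G.g t) : G.Cok) = 0 :=
  (Submodule.Quotient.mk_eq_zero _).2 ⟨t, rfl⟩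

theorem mk_eq_zero {G : MoritaTuple A B M N} {x : G.X} :
    (Submodule.Quotient.mk x : G.Cok) = 0 ↔ ∃ t, G.g t = x :=
  Submodule.Quotient.mk_eq_zero _

namespace Hom

variable {G H K : MoritaTuple A B M N}

/-- The morphism with the roles of the two corners exchanged. -/
abbrev swap (φ : Hom G H) : Hom G.swap H.swap where
  α := φ.β
  β := φ.α
  comm_f := φ.comm_g
  comm_g := φ.comm_f

/-- Composition of morphisms. -/
def comp (ψ : Hom H K) (φ : Hom G H) : Hom G K where
  α := ψ.α ∘ₗ φ.α
  β := ψ.β ∘ₗ φ.β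
  comm_f m x := by simp [φ.comm_f, ψ.comm_f]
  comm_g m x := by simp [φ.comm_g, ψ.comm_g]

instance : Sub (Hom G H) :=
  ⟨fun φ ψ =>
    { α := φ.α - ψ.α
      β := φ.β - ψ.β
      comm_f := fun m x => by simp [φ.comm_f, ψ.comm_f, tmul_sub]
      comm_g := fun n y => by simp [φ.comm_g, ψ.comm_g, tmul_sub] }⟩

theorem g_apply (φ : Hom G H) (t : BalancedTensor B N G.Y) :
    φ.α (G.g t) = H.g (map A N φ.β t) := by
  induction t using induction_on with
  | zero => simp
  | tmul n y => exact φ.comm_g n y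
  | add s t hs ht => simp only [map_add, hs, ht]

/-- The induced map on cokernels. -/
def cokMap (φ : Hom G H) : G.Cok →ₗ[A] H.Cok :=
  Submodule.mapQ _ _ φ.α (by
    rintro _ ⟨t, rfl⟩
    exact ⟨_, (φ.g_apply t).symm⟩)

@[simp]
theorem cokMap_mk (φ : Hom G H) (x : G.X) :
    φ.cokMap (Submodule.Quotient.mk x) = Submodule.Quotient.mk (φ.α x) := rfl

end Hom

/-- Short exact sequences of quadruples. -/
structure IsSES {K U G : MoritaTuple A B M N} (i : Hom K U) (p : Hom U G) : Prop where
  fst : IsShortExact i.α p.α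
  snd : IsShortExact i.β p.β

theorem IsSES.swap {K U G : MoritaTuple A B M N} {i : Hom K U} {p : Hom U G} (h : IsSES i p) :
    IsSES i.swap p.swap := ⟨h.snd, h.fst⟩

variable (A B M N) in
/-- The quadruple `(P ⊕ N ⊗ Q, M ⊗ P ⊕ Q)` which corresponds to the module induced by `P`
and `Q`. -/
abbrev free (P Q : Type u) [AddCommGroup P] [Module A P] [AddCommGroup Q] [Module B Q] :
    MoritaTuple A B M N where
  X := P × BalancedTensor B N Q
  Y := BalancedTensor A M P × Q
  f := LinearMap.inl B _ _ ∘ₗ map B M (LinearMap.fst A _ _)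
  g := LinearMap.inr A _ _ ∘ₗ map A N (LinearMap.snd B _ _)

variable [Module.Finite B M] [Module.Finite Aᵐᵒᵖ M] [Module.Finite A N] [Module.Finite Bᵐᵒᵖ N]
variable [Module.Projective B M] [Module.Projective Aᵐᵒᵖ M] [Module.Projective A N]
  [Module.Projective Bᵐᵒᵖ N]
variable [Subsingleton (BalancedTensor A M N)] [Subsingleton (BalancedTensor B N M)]

theorem exists_map_eq {Y Y' Y'' : Type u} [AddCommGroup Y] [Module B Y] [AddCommGroup Y']
    [Module B Y'] [AddCommGroup Y''] [Module B Y''] {i : Y →ₗ[B] Y'} {p : Y' →ₗ[B] Y''}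
    (h : IsShortExact i p) {t : BalancedTensor B N Y'} (ht : map A N p t = 0) :
    ∃ s, map A N i s = t := by
  obtain ⟨n, e, x, hx, rfl⟩ := exists_of_map_eq_zero ht
  choose k hk using fun j => (h.exact (x j)).1 (hx j)
  exact ⟨∑ j, tmul B (e j) (k j), by simp [hk]⟩

theorem g_f (G : MoritaTuple A B M N) (n : N) (t : BalancedTensor A M G.X) :
    G.g (tmul B n (G.f t)) = 0 := by
  rw [tmul_apply_eq_zero, map_zero]

/-- The kernel is generated by the elements `n ⊗ f(s)`, which vanish because `N ⊗ M = 0`. Hence `N ⊗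
Y` and `N ⊗ Coker f` coincide, which lets `g` be controlled by `Coker f`. -/
theorem map_mkQ_injective (G : MoritaTuple A B M N) :
    Function.Injective (map A N (LinearMap.range G.f).mkQ) := by
  rw [injective_iff_map_eq_zero]
  intro t ht
  obtain ⟨n, e, x, hx, rfl⟩ := exists_of_map_eq_zero ht
  refine Finset.sum_eq_zero fun j _ => ?_
  obtain ⟨s, hs⟩ := (Submodule.Quotient.mk_eq_zero _).1 (hx j)
  rw [← hs, tmul_apply_eq_zero]

/-! ### The snake lemma for the structure map `g`. -/

section Snake

variable {K U G : MoritaTuple A B M N} {i : Hom K U} {p : Hom U G}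

/-- `i.α ∘ K.g` equals `U.g ∘ (N ⊗ i.β)`, and `N ⊗ -` preserves injectivity. -/
theorem injective_g_of_hom (hi : Function.Injective i.β)
    (hU : Function.Injective U.g) : Function.Injective K.g := by
  rw [injective_iff_map_eq_zero]
  intro t ht
  refine (injective_iff_map_eq_zero (map A N i.β)).1 (map_injective hi) _ ?_
  refine (injective_iff_map_eq_zero U.g).1 hU _ ?_
  rw [← i.g_apply, ht, map_zero]

/-- Snake lemma for `N ⊗ -` of the second components mapping to the first components: the only
obstruction to left exactness is `Ker G.g`. -/
theorem IsSES.cok (h : IsSES i p) (hG : Function.Injective G.g) :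
    IsShortExact i.cokMap p.cokMap where
  injective := by
    rw [injective_iff_map_eq_zero]
    intro x hx
    obtain ⟨x, rfl⟩ := Submodule.Quotient.mk_surjective _ x
    obtain ⟨t, ht⟩ := mk_eq_zero.1 hx
    obtain ⟨s, rfl⟩ := exists_map_eq (A := A) (t := t) h.snd (by
      refine (injective_iff_map_eq_zero G.g).1 hG _ ?_
      rw [← p.g_apply, ht]
      exact (h.fst.exact _).2 ⟨x, rfl⟩)
    rw [← i.g_apply] at ht
    exact mk_eq_zero.2 ⟨s, h.fst.injective ht⟩
  exact x := by
    obtain ⟨x, rfl⟩ := Submodule.Quotient.mk_surjective _ x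
    constructor
    · intro hx
      obtain ⟨t, ht⟩ := mk_eq_zero.1 hx
      obtain ⟨s, rfl⟩ := map_surjective (B := A) h.snd.surjective t
      rw [← p.g_apply, eq_comm, ← sub_eq_zero, ← map_sub] at ht
      obtain ⟨k, hk⟩ := (h.fst.exact _).1 ht
      refine ⟨Submodule.Quotient.mk k, ?_⟩
      rw [Hom.cokMap_mk, hk, Submodule.Quotient.mk_sub, mk_g, sub_zero]
    · rintro ⟨y, hy⟩
      obtain ⟨y, rfl⟩ := Submodule.Quotient.mk_surjective _ y
      rw [← hy, Hom.cokMap_mk, Hom.cokMap_mk, (h.fst.exact _).2 ⟨y, rfl⟩,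
        Submodule.Quotient.mk_zero]
  surjective x := by
    obtain ⟨x, rfl⟩ := Submodule.Quotient.mk_surjective _ x
    obtain ⟨y, rfl⟩ := h.fst.surjective x
    exact ⟨Submodule.Quotient.mk y, rfl⟩

/-- Read off the same snake: injectivity on cokernels kills the connecting map out of `Ker G.g`, so
this kernel is covered by `Ker U.g = 0`. -/
theorem IsSES.injective_g (h : IsSES i p) (hU : Function.Injective U.g)
    (hi : Function.Injective i.cokMap) : Function.Injective G.g := by
  rw [injective_iff_map_eq_zero]
  intro t ht
  obtain ⟨t, rfl⟩ := map_surjective (B := A) h.snd.surjective t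
  rw [← p.g_apply] at ht
  obtain ⟨x, hx⟩ := (h.fst.exact _).1 ht
  obtain ⟨s, rfl⟩ := mk_eq_zero.1 ((injective_iff_map_eq_zero i.cokMap).1 hi
    (Submodule.Quotient.mk x) (by rw [Hom.cokMap_mk, hx, mk_g]))
  rw [i.g_apply] at hx
  rw [← hU hx, map_map]
  have : p.β ∘ₗ i.β = 0 := LinearMap.ext fun y => (h.snd.exact _).2 ⟨y, rfl⟩
  rw [this]
  clear ht hx
  induction s using induction_on with
  | zero => simp
  | tmul n y => simp [tmul_zero]
  | add s t hs ht => simp only [map_add, hs, ht, add_zero]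

/-- A map on `K` which factors over the cokernel of `g` extends along a short exact sequence. -/
theorem IsSES.exists_extension (h : IsSES i p) (hG : Function.Injective G.g)
    (hext : ExtVanishing A G.Cok) {W : Type u} [AddCommGroup W] [Module A W] [Module.Finite A W]
    [Module.Projective A W] (δ : K.X →ₗ[A] W) (hδ : ∀ t, δ (K.g t) = 0) :
    ∃ ε : U.X →ₗ[A] W, (∀ t, ε (U.g t) = 0) ∧ ∀ x, ε (i.α x) = δ x := by
  obtain ⟨k, hk⟩ := hext _ _ _ _ (h.cok hG) W ((LinearMap.range K.g).liftQ δ (by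
    rintro _ ⟨t, rfl⟩; exact hδ t))
  refine ⟨k ∘ₗ (LinearMap.range U.g).mkQ, fun t => ?_, fun x =>
    LinearMap.congr_fun hk (Submodule.Quotient.mk x)⟩
  rw [LinearMap.comp_apply, Submodule.mkQ_apply, mk_g, map_zero]

end Snake

/-! ### The quadruples `free P Q` and their universal property. -/

section Free

variable {P Q : Type u} [AddCommGroup P] [Module A P] [AddCommGroup Q] [Module B Q]

theorem free_f_tmul (m : M) (x : P × BalancedTensor B N Q) :
    (free A B M N P Q).f (tmul A m x) = (tmul A m x.1, 0) := rfl

theorem free_g_tmul (n : N) (y : BalancedTensor A M P × Q) :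
    (free A B M N P Q).g (tmul B n y) = (0, tmul B n y.2) := rfl

/-- The morphism out of `free A B M N P Q` determined by `P ⟶ X` and `Q ⟶ Y`. -/
def desc (G : MoritaTuple A B M N) (a : P →ₗ[A] G.X) (b : Q →ₗ[B] G.Y) : Hom (free A B M N P Q) G where
  α := a.coprod (G.g ∘ₗ map A N b)
  β := (G.f ∘ₗ map B M a).coprod b
  comm_f m x := by
    obtain ⟨x, t⟩ := x
    have : G.f (tmul A m (G.g (map A N b t))) = 0 := G.swap.g_f m _
    rw [free_f_tmul]
    change G.f (map B M a (tmul A m x)) + b 0 = G.f (tmul A m (a x + G.g (map A N b t)))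
    rw [tmul_add, map_add, this, map_zero, map_tmul]
  comm_g n y := by
    obtain ⟨s, y⟩ := y
    have : G.g (tmul B n (G.f (map B M a s))) = 0 := G.g_f n _
    rw [free_g_tmul]
    change a 0 + G.g (map A N b (tmul B n y)) = G.g (tmul B n (G.f (map B M a s) + b y))
    rw [tmul_add, map_add, this, map_zero, map_tmul]

theorem desc_α (G : MoritaTuple A B M N) (a : P →ₗ[A] G.X) (b : Q →ₗ[B] G.Y) (x) :
    (G.desc a b).α x = a x.1 + G.g (map A N b x.2) := rfl

theorem desc_β (G : MoritaTuple A B M N) (a : P →ₗ[A] G.X) (b : Q →ₗ[B] G.Y) (y) :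
    (G.desc a b).β y = G.f (map B M a y.1) + b y.2 := rfl

/-- The exchange of corners for `free`. -/
def freeSwap : Hom (free A B M N P Q).swap (free B A N M Q P) where
  α := (LinearMap.snd B _ _).prod (LinearMap.fst B _ _)
  β := (LinearMap.snd A _ _).prod (LinearMap.fst A _ _)
  comm_f _ _ := rfl
  comm_g _ _ := rfl

/-- The kernel of `N ⊗ (M ⊗ P ⊕ Q) ⟶ N ⊗ Q` comes from `N ⊗ M ⊗ P = 0`. -/
theorem free_g_injective : Function.Injective (free A B M N P Q).g := by
  rw [injective_iff_map_eq_zero]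
  intro t ht
  have ht' : map A N (LinearMap.snd B (BalancedTensor A M P) Q) t = 0 := congrArg Prod.snd ht
  obtain ⟨n, e, x, hx, rfl⟩ := exists_of_map_eq_zero ht'
  refine Finset.sum_eq_zero fun j _ => ?_
  have : x j = LinearMap.inl B _ _ (x j).1 := Prod.ext rfl (hx j)
  rw [this, tmul_apply_eq_zero]

/-- The canonical map from `P` to the cokernel of `g` for `free A B M N P Q`. -/
def freeCok : P →ₗ[A] (free A B M N P Q).Cok :=
  (LinearMap.range (free A B M N P Q).g).mkQ ∘ₗ LinearMap.inl A P (BalancedTensor B N Q)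

theorem freeCok_fst (x : (free A B M N P Q).X) :
    (freeCok x.1 : (free A B M N P Q).Cok) = Submodule.Quotient.mk x := by
  obtain ⟨s, hs⟩ := map_surjective (B := A) (M := N)
    (h := LinearMap.snd B (BalancedTensor A M P) Q) Prod.snd_surjective x.2
  refine ((Submodule.Quotient.eq (LinearMap.range (free A B M N P Q).g)).2
    (LinearMap.mem_range.2 ⟨s, Prod.ext ?_ ?_⟩)).symm
  · exact (sub_self x.1).symm
  · exact hs.trans (sub_zero x.2).symm

theorem freeCok_bijective :
    Function.Bijective (freeCok : P →ₗ[A] (free A B M N P Q).Cok) := by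
  constructor
  · rw [injective_iff_map_eq_zero]
    intro x hx
    obtain ⟨t, ht⟩ := mk_eq_zero.1 hx
    exact (congrArg Prod.fst ht).symm
  · intro x
    obtain ⟨x, rfl⟩ := Submodule.Quotient.mk_surjective _ x
    exact ⟨x.1, freeCok_fst x⟩

variable (A B M N P Q) in
/-- The cokernel of `g` for `free A B M N P Q` is `P`. -/
noncomputable def freeCokEquiv : P ≃ₗ[A] (free A B M N P Q).Cok :=
  LinearEquiv.ofBijective freeCok freeCok_bijective

theorem freeCokEquiv_fst (x : (free A B M N P Q).X) :
    freeCokEquiv A B M N P Q x.1 = Submodule.Quotient.mk x := freeCok_fst x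

end Free

/-- The quadruples which correspond to the finitely generated projective modules. -/
def Perf (U : MoritaTuple A B M N) : Prop :=
  ∃ (P Q : Type u) (_ : AddCommGroup P) (_ : Module A P) (_ : AddCommGroup Q) (_ : Module B Q),
    Module.Finite A P ∧ Module.Projective A P ∧ Module.Finite B Q ∧ Module.Projective B Q ∧
    ∃ (s : Hom U (free A B M N P Q)) (r : Hom (free A B M N P Q) U),
      (∀ x, r.α (s.α x) = x) ∧ ∀ y, r.β (s.β y) = y

theorem perf_free {P Q : Type u} [AddCommGroup P] [Module A P] [AddCommGroup Q] [Module B Q]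
    [Module.Finite A P] [Module.Projective A P] [Module.Finite B Q] [Module.Projective B Q] :
    (free A B M N P Q).Perf :=
  ⟨P, Q, _, _, _, _, inferInstance, inferInstance, inferInstance, inferInstance,
    ⟨LinearMap.id, LinearMap.id, fun _ _ => rfl, fun _ _ => rfl⟩,
    ⟨LinearMap.id, LinearMap.id, fun _ _ => rfl, fun _ _ => rfl⟩, fun _ => rfl, fun _ => rfl⟩

namespace Perf

variable {U : MoritaTuple A B M N}

theorem swap (h : U.Perf) : U.swap.Perf := by
  obtain ⟨P, Q, _, _, _, _, h1, h2, h3, h4, s, r, hs, hr⟩ := h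
  exact ⟨Q, P, _, _, _, _, h3, h4, h1, h2, freeSwap.comp s.swap, r.swap.comp freeSwap.swap, hr, hs⟩

theorem g_injective (h : U.Perf) : Function.Injective U.g := by
  obtain ⟨P, Q, _, _, _, _, h1, h2, h3, h4, s, r, hs, hr⟩ := h
  exact injective_g_of_hom (Function.LeftInverse.injective hr) free_g_injective

/-- `Coker g` is functorial and sends `free P Q` to `P`, so retracts go to retracts. -/
theorem exists_cok_retract (h : U.Perf) : ∃ (P : Type u) (_ : AddCommGroup P) (_ : Module A P)
    (s : U.Cok →ₗ[A] P) (r : P →ₗ[A] U.Cok), Module.Finite A P ∧ Module.Projective A P ∧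
      r ∘ₗ s = LinearMap.id := by
  obtain ⟨P, Q, _, _, _, _, h1, h2, h3, h4, s, r, hs, hr⟩ := h
  refine ⟨P, _, _, (freeCokEquiv A B M N P Q).symm.toLinearMap ∘ₗ s.cokMap,
    r.cokMap ∘ₗ (freeCokEquiv A B M N P Q).toLinearMap, h1, h2, ?_⟩
  refine LinearMap.ext fun x => ?_
  obtain ⟨x, rfl⟩ := Submodule.Quotient.mk_surjective _ x
  simp only [LinearMap.comp_apply, LinearEquiv.coe_coe, LinearEquiv.apply_symm_apply]
  exact congrArg Submodule.Quotient.mk (hs x)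

theorem cok_projective (h : U.Perf) : Module.Projective A U.Cok := by
  obtain ⟨P, _, _, s, r, _, _, hrs⟩ := h.exists_cok_retract
  exact Module.Projective.of_split s r hrs

theorem cok_finite (h : U.Perf) : Module.Finite A U.Cok := by
  obtain ⟨P, _, _, s, r, _, _, hrs⟩ := h.exists_cok_retract
  exact Module.Finite.of_surjective r fun t => ⟨s t, LinearMap.congr_fun hrs t⟩

/-- The image of `g` is isomorphic to `N ⊗ Coker f`. -/
theorem nonempty_range_equiv (h : U.Perf) :
    Nonempty (BalancedTensor B N U.swap.Cok ≃ₗ[A] LinearMap.range U.g) :=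
  ⟨(LinearEquiv.ofBijective (map A N (LinearMap.range U.f).mkQ)
    ⟨U.map_mkQ_injective, map_surjective (Submodule.mkQ_surjective _)⟩).symm.trans
    (LinearEquiv.ofInjective U.g h.g_injective)⟩

theorem range_projective (h : U.Perf) : Module.Projective A (LinearMap.range U.g) := by
  obtain ⟨e⟩ := h.nonempty_range_equiv
  have := h.swap.cok_finite
  have := h.swap.cok_projective
  exact Module.Projective.of_equiv' e

theorem range_finite (h : U.Perf) : Module.Finite A (LinearMap.range U.g) := by
  obtain ⟨e⟩ := h.nonempty_range_equiv
  have := h.swap.cok_finite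
  have := h.swap.cok_projective
  exact Module.Finite.equiv e

end Perf

end MoritaTuple

end MoritaTuple

/-! ### Resolving classes of quadruples and their cokernels. -/

section MoritaTuple

open BalancedTensor

theorem ExtVanishing.of_projective {S : Type u} [Ring S] (G : Type u) [AddCommGroup G] [Module S G]
    [Module.Projective S G] : ExtVanishing S G := by
  refine ExtVanishing.of_projective_presentation (K := PUnit.{u + 1}) (P := G) (i := 0)
    (p := LinearMap.id) ⟨Function.injective_of_subsingleton _, fun x => ?_, fun x => ⟨x, rfl⟩⟩ ?_
  · simp [eq_comm]
  · intro Q _ _ _ _ h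
    exact ⟨0, Subsingleton.elim _ _⟩

theorem IsShortExact.equiv_middle {S : Type*} [Ring S] {K P P' G : Type*} [AddCommGroup K]
    [Module S K] [AddCommGroup P] [Module S P] [AddCommGroup P'] [Module S P'] [AddCommGroup G]
    [Module S G] {i : K →ₗ[S] P} {p : P →ₗ[S] G} (h : IsShortExact i p) (e : P ≃ₗ[S] P') :
    IsShortExact (e.toLinearMap ∘ₗ i) (p ∘ₗ e.symm.toLinearMap) where
  injective := e.injective.comp h.injective
  exact x := by
    rw [LinearMap.comp_apply, h.exact]
    exact ⟨fun ⟨k, hk⟩ => ⟨k, by simp [hk]⟩, fun ⟨k, hk⟩ => ⟨k, by simp [← hk]⟩⟩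
  surjective := h.surjective.comp e.symm.surjective

namespace MoritaTuple

variable {A B M N : Type u} [Ring A] [Ring B]
variable [AddCommGroup M] [Module B M] [Module Aᵐᵒᵖ M] [SMulCommClass B Aᵐᵒᵖ M]
variable [AddCommGroup N] [Module A N] [Module Bᵐᵒᵖ N] [SMulCommClass A Bᵐᵒᵖ N]
variable [Module.Finite B M] [Module.Finite Aᵐᵒᵖ M] [Module.Finite A N] [Module.Finite Bᵐᵒᵖ N]
variable [Module.Projective B M] [Module.Projective Aᵐᵒᵖ M] [Module.Projective A N]
  [Module.Projective Bᵐᵒᵖ N]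
variable [Subsingleton (BalancedTensor A M N)] [Subsingleton (BalancedTensor B N M)]

/-- Classes of quadruples which are closed under suitable syzygies and cosyzygies. -/
structure IsResolvingClass (𝒯 : MoritaTuple A B M N → Prop) : Prop where
  right : ∀ G, 𝒯 G → ∃ (U G' : MoritaTuple A B M N) (i : Hom G U) (p : Hom U G'),
    U.Perf ∧ IsSES i p ∧ 𝒯 G'
  left : ∀ G, 𝒯 G → ∃ (K U : MoritaTuple A B M N) (i : Hom K U) (p : Hom U G),
    U.Perf ∧ IsSES i p ∧ 𝒯 K ∧ ∀ V : MoritaTuple A B M N, V.Perf → ∀ h : Hom K V,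
      ∃ k : Hom U V, (∀ x, k.α (i.α x) = h.α x) ∧ ∀ y, k.β (i.β y) = h.β y

namespace IsResolvingClass

variable {𝒯 : MoritaTuple A B M N → Prop}

theorem swap (h : IsResolvingClass 𝒯) :
    IsResolvingClass (fun G : MoritaTuple B A N M => 𝒯 G.swap) where
  right G hG := by
    obtain ⟨U, G', i, p, h1, h2, h3⟩ := h.right _ hG
    exact ⟨U.swap, G'.swap, i.swap, p.swap, h1.swap, h2.swap, h3⟩
  left G hG := by
    obtain ⟨K, U, i, p, h1, h2, h3, h4⟩ := h.left _ hG
    refine ⟨K.swap, U.swap, i.swap, p.swap, h1.swap, h2.swap, h3, fun V hV φ => ?_⟩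
    obtain ⟨k, hk, hk'⟩ := h4 V.swap hV.swap φ.swap
    exact ⟨k.swap, hk', hk⟩

theorem injective_g (h : IsResolvingClass 𝒯) {G : MoritaTuple A B M N} (hG : 𝒯 G) :
    Function.Injective G.g := by
  obtain ⟨U, G', i, p, h1, h2, h3⟩ := h.right _ hG
  exact injective_g_of_hom h2.snd.injective h1.g_injective

/-- Maps from `X` to a finitely generated projective module which vanish on the image of `g` lift
to morphisms of quadruples. -/
theorem exists_hom_free (h : IsResolvingClass 𝒯) {K : MoritaTuple A B M N} (hK : 𝒯 K)
    {V : Type u} [AddCommGroup V] [Module A V] [Module.Finite A V] [Module.Projective A V]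
    (δ : K.X →ₗ[A] V) (hδ : ∀ t, δ (K.g t) = 0) :
    ∃ φ : Hom K (free A B M N V PUnit.{u + 1}), ∀ x, (φ.α x).1 = δ x := by
  obtain ⟨K', U, i, p, hU, hses, hK', hext⟩ := h.left K hK
  have := hU.swap.cok_projective
  have hfU : IsShortExact U.f (LinearMap.range U.f).mkQ :=
    ⟨hU.swap.g_injective, LinearMap.exact_map_mkQ_range _, Submodule.mkQ_surjective _⟩
  -- A second component for `δ ∘ p` exists on `U`, since `U.f` is injective with projective
  -- cokernel. It need not vanish on `K'`, so it does not descend to `K` yet.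
  obtain ⟨b, hb⟩ := ExtVanishing.of_projective (S := B) U.swap.Cok _ _ _ _ hfU
    (BalancedTensor A M V) (map B M (δ ∘ₗ p.α))
  have hb' (t) : b (U.f t) = map B M (δ ∘ₗ p.α) t := LinearMap.congr_fun hb t
  have hpi (x) : p.α (i.α x) = 0 := (hses.fst.exact _).2 ⟨x, rfl⟩
  have hsub : Subsingleton (BalancedTensor B N (BalancedTensor A M V)) := subsingleton_tensor
  -- The obstruction `b ∘ i.β` kills the image of `K'.f`, so it is a morphism to `free 0 (M ⊗ V)`,
  -- whose first component is `N ⊗ M ⊗ V = 0`. Extended to `U` and subtracted from `b`, it leaves a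
  -- map that descends to `K.Y`; the values on the image of `f` are unchanged.
  let ψ : Hom K' (free A B M N PUnit.{u + 1} (BalancedTensor A M V)) :=
    { α := 0
      β := LinearMap.inr B _ _ ∘ₗ b ∘ₗ i.β
      comm_f := fun m x => by
        refine Prod.ext ?_ ?_
        · exact (tmul_zero m).symm
        · change b (i.β (K'.f (tmul A m x))) = 0
          rw [i.comm_f, hb', map_tmul, LinearMap.comp_apply, hpi, map_zero, tmul_zero]
      comm_g := fun n y => Prod.ext rfl (hsub.elim _ _) }
  obtain ⟨k, -, hk⟩ := hext _ perf_free ψ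
  obtain ⟨β, hβ⟩ := LinearMap.exists_comp_eq_of_surjective hses.snd.surjective
    (b - LinearMap.snd B (BalancedTensor A M PUnit.{u + 1}) (BalancedTensor A M V) ∘ₗ k.β) (by
      intro y hy
      obtain ⟨z, rfl⟩ := (hses.snd.exact y).1 hy
      rw [LinearMap.sub_apply, LinearMap.comp_apply, hk, sub_eq_zero]
      rfl)
  refine ⟨⟨LinearMap.inl A _ _ ∘ₗ δ, LinearMap.inl B _ _ ∘ₗ β, fun m x => ?_, fun n y => ?_⟩,
    fun x => rfl⟩
  · refine Prod.ext ?_ rfl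
    change β (K.f (tmul A m x)) = tmul A m (δ x)
    obtain ⟨x, rfl⟩ := hses.fst.surjective x
    rw [← p.comm_f]
    refine (LinearMap.congr_fun hβ _).trans ?_
    rw [LinearMap.sub_apply, hb', LinearMap.comp_apply, k.comm_f]
    exact sub_zero _
  · refine Prod.ext ?_ ?_
    · exact hδ _
    · exact (tmul_zero n).symm

/-- The modules `Coker g` with `G` in the class satisfy the coinductive principle. A map from
`K.Cok` to a projective `V` becomes a morphism to `free V 0`, is extended to `U` there, and its
first coordinate descends to `U.Cok`. -/
theorem gorensteinProjective_cok (h : IsResolvingClass 𝒯) {G : MoritaTuple A B M N} (hG : 𝒯 G) :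
    IsGorensteinProjective A G.Cok := by
  refine IsGorensteinProjective.of_class
    (fun Z _ _ => ∃ G : MoritaTuple A B M N, 𝒯 G ∧ Nonempty (Z ≃ₗ[A] G.Cok)) ?_ ?_ _
    ⟨G, hG, ⟨LinearEquiv.refl _ _⟩⟩
  · rintro Z _ _ ⟨G, hG, ⟨e⟩⟩
    obtain ⟨U, G', i, p, hU, hses, hG'⟩ := h.right _ hG
    exact ⟨U.Cok, G'.Cok, _, _, _, _, _, _, hU.cok_finite, hU.cok_projective,
      (hses.cok (h.injective_g hG')).equiv_comp e, G', hG', ⟨LinearEquiv.refl _ _⟩⟩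
  · rintro Z _ _ ⟨G, hG, ⟨e⟩⟩
    obtain ⟨K, U, i, p, hU, hses, hK, hext⟩ := h.left _ hG
    refine ⟨K.Cok, U.Cok, _, _, _, _, _, _, hU.cok_finite, hU.cok_projective,
      (hses.cok (h.injective_g hG)).comp_equiv e.symm, ⟨K, hK, ⟨LinearEquiv.refl _ _⟩⟩, ?_⟩
    intro V _ _ _ _ δ
    obtain ⟨φ, hφ⟩ := h.exists_hom_free hK (δ ∘ₗ (LinearMap.range K.g).mkQ)
      (fun t => by rw [LinearMap.comp_apply, Submodule.mkQ_apply, mk_g, map_zero])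
    obtain ⟨k, hk, -⟩ := hext _ perf_free φ
    refine ⟨(LinearMap.range U.g).liftQ (LinearMap.fst A _ _ ∘ₗ k.α) ?_, ?_⟩
    · rintro _ ⟨t, rfl⟩
      -- The structure map `g` of `free V 0` has zero first coordinate.
      rw [LinearMap.mem_ker, LinearMap.comp_apply, k.g_apply]
      rfl
    · refine LinearMap.ext fun x => ?_
      obtain ⟨x, rfl⟩ := Submodule.Quotient.mk_surjective _ x
      exact (congrArg Prod.fst (hk x)).trans (hφ x)

end IsResolvingClass

/-! ### Monic quadruples with Gorenstein-projective cokernels -/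

/-- Quadruples with injective structure maps whose cokernels are Gorenstein-projective. -/
structure IsMonicGP (G : MoritaTuple A B M N) : Prop where
  injective_g : Function.Injective G.g
  injective_f : Function.Injective G.f
  cok_g : IsGorensteinProjective A G.Cok
  cok_f : IsGorensteinProjective B G.swap.Cok

theorem IsMonicGP.swap {G : MoritaTuple A B M N} (h : G.IsMonicGP) : G.swap.IsMonicGP :=
  ⟨h.injective_f, h.injective_g, h.cok_f, h.cok_g⟩

theorem IsResolvingClass.isMonicGP {𝒯 : MoritaTuple A B M N → Prop} (h : IsResolvingClass 𝒯)
    {G : MoritaTuple A B M N} (hG : 𝒯 G) : G.IsMonicGP :=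
  ⟨h.injective_g hG, h.swap.injective_g (G := G.swap) hG, h.gorensteinProjective_cok hG,
    h.swap.gorensteinProjective_cok (G := G.swap) hG⟩

theorem exists_cokernel_g {G H : MoritaTuple A B M N} (φ : Hom G H) :
    ∃ g' : BalancedTensor B N (H.Y ⧸ LinearMap.range φ.β) →ₗ[A] H.X ⧸ LinearMap.range φ.α,
      ∀ n y, g' (tmul B n (Submodule.Quotient.mk y)) = Submodule.Quotient.mk (H.g (tmul B n y)) := by
  obtain ⟨g', hg'⟩ := LinearMap.exists_comp_eq_of_surjective
    (map_surjective (B := A) (M := N) (LinearMap.range φ.β).mkQ_surjective)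
    ((LinearMap.range φ.α).mkQ ∘ₗ H.g) (by
      intro t ht
      obtain ⟨n, e, x, hx, rfl⟩ := exists_of_map_eq_zero ht
      rw [map_sum]
      refine Finset.sum_eq_zero fun j _ => ?_
      obtain ⟨y, hy⟩ := (Submodule.Quotient.mk_eq_zero _).1 (hx j)
      rw [← hy, LinearMap.comp_apply, ← φ.comm_g]
      exact (Submodule.Quotient.mk_eq_zero _).2 ⟨_, rfl⟩)
  exact ⟨g', fun n y => LinearMap.congr_fun hg' (tmul B n y)⟩

theorem exists_cokernel {G H : MoritaTuple A B M N} (φ : Hom G H)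
    (hα : Function.Injective φ.α) (hβ : Function.Injective φ.β) :
    ∃ (G' : MoritaTuple A B M N) (p : Hom H G'), IsSES φ p := by
  obtain ⟨g', hg'⟩ := exists_cokernel_g φ
  obtain ⟨f', hf'⟩ := exists_cokernel_g φ.swap
  refine ⟨⟨_, _, f', g'⟩, ⟨Submodule.mkQ _, Submodule.mkQ _, fun m x => (hf' m x).symm,
    fun n y => (hg' n y).symm⟩,
    ⟨hα, LinearMap.exact_map_mkQ_range _, Submodule.mkQ_surjective _⟩,
    ⟨hβ, LinearMap.exact_map_mkQ_range _, Submodule.mkQ_surjective _⟩⟩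

/-- The restriction of `g` to the kernels of a morphism. -/
def kernelG {G H : MoritaTuple A B M N} (φ : Hom G H) :
    BalancedTensor B N (LinearMap.ker φ.β) →ₗ[A] LinearMap.ker φ.α :=
  (G.g ∘ₗ map A N (LinearMap.ker φ.β).subtype).codRestrict _ (fun t => by
    rw [LinearMap.mem_ker, LinearMap.comp_apply, φ.g_apply, map_map]
    induction t using induction_on with
    | zero => simp
    | tmul n y => simp [tmul_zero]
    | add s t hs ht => simp only [map_add, hs, ht, add_zero])

theorem exists_kernel {G H : MoritaTuple A B M N} (φ : Hom G H)
    (hα : Function.Surjective φ.α) (hβ : Function.Surjective φ.β) :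
    ∃ (K : MoritaTuple A B M N) (i : Hom K G), IsSES i φ :=
  ⟨⟨_, _, kernelG φ.swap, kernelG φ⟩, ⟨Submodule.subtype _, Submodule.subtype _,
    fun _ _ => rfl, fun _ _ => rfl⟩,
    ⟨Subtype.val_injective, LinearMap.exact_subtype_ker_map _, hα⟩,
    ⟨Subtype.val_injective, LinearMap.exact_subtype_ker_map _, hβ⟩⟩

section Free

variable {P Q : Type u} [AddCommGroup P] [Module A P] [AddCommGroup Q] [Module B Q]
variable {K G : MoritaTuple A B M N}

theorem IsSES.freeSwap_right {i : Hom K (free A B M N P Q)} {p : Hom (free A B M N P Q) G}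
    (h : IsSES i p) : IsSES (freeSwap.comp i.swap) (p.swap.comp freeSwap.swap) :=
  ⟨h.snd.equiv_middle (LinearEquiv.prodComm B _ _), h.fst.equiv_middle (LinearEquiv.prodComm A _ _)⟩

/-- The cokernel of `g` of a cosyzygy. -/
theorem IsSES.cosyzygy {C' : Type u} [AddCommGroup C'] [Module A C']
    {i : Hom K (free A B M N P Q)} {p : Hom (free A B M N P Q) G} (h : IsSES i p)
    {i₁ : K.Cok →ₗ[A] P} {p₁ : P →ₗ[A] C'} (h₁ : IsShortExact i₁ p₁)
    (hi : ∀ x, (i.α x).1 = i₁ (Submodule.Quotient.mk x)) (hC : IsGorensteinProjective A C') :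
    Function.Injective G.g ∧ IsGorensteinProjective A G.Cok := by
  have hcok : i.cokMap = (freeCokEquiv A B M N P Q).toLinearMap ∘ₗ i₁ := by
    refine LinearMap.ext fun x => ?_
    obtain ⟨x, rfl⟩ := Submodule.Quotient.mk_surjective _ x
    rw [LinearMap.comp_apply, ← hi]
    exact (freeCokEquiv_fst _).symm
  have h₂ := h₁.equiv_middle (freeCokEquiv A B M N P Q)
  rw [← hcok] at h₂
  have hg := h.injective_g free_g_injective h₂.injective
  obtain ⟨e⟩ := (h.cok hg).nonempty_equiv h₂
  exact ⟨hg, hC.of_equiv e⟩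

/-- The cokernel of `g` of a syzygy. -/
theorem IsSES.syzygy {C' : Type u} [AddCommGroup C'] [Module A C']
    {i : Hom K (free A B M N P Q)} {p : Hom (free A B M N P Q) G} (h : IsSES i p)
    (hg : Function.Injective G.g)
    {i₁ : C' →ₗ[A] P} {p₁ : P →ₗ[A] G.Cok} (h₁ : IsShortExact i₁ p₁)
    (hp : ∀ x : P, Submodule.Quotient.mk (p.α (x, 0)) = p₁ x) (hC : IsGorensteinProjective A C') :
    Function.Injective K.g ∧ IsGorensteinProjective A K.Cok := by
  have hcok : p.cokMap ∘ₗ (freeCokEquiv A B M N P Q).toLinearMap = p₁ := LinearMap.ext hp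
  have h₂ := (h.cok hg).equiv_middle (freeCokEquiv A B M N P Q).symm
  rw [LinearEquiv.symm_symm, hcok] at h₂
  obtain ⟨e⟩ := h₂.nonempty_equiv_left h₁
  exact ⟨injective_g_of_hom h.snd.injective free_g_injective, hC.of_equiv e⟩

end Free

theorem IsMonicGP.isShortExact {G : MoritaTuple A B M N} (h : G.IsMonicGP) :
    IsShortExact G.g (LinearMap.range G.g).mkQ :=
  ⟨h.injective_g, LinearMap.exact_map_mkQ_range _, Submodule.mkQ_surjective _⟩

/-- `N ⊗ Q` is finitely generated projective over `A`, so `Ext¹(Coker g, N ⊗ Q) = 0`. This yields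
the second coordinate of the embedding `X ⟶ P ⊕ N ⊗ Q`. -/
theorem IsMonicGP.exists_map {G : MoritaTuple A B M N} (h : G.IsMonicGP)
    {Q : Type u} [AddCommGroup Q] [Module B Q] [Module.Finite B Q] [Module.Projective B Q]
    (j : G.Y →ₗ[B] Q) :
    ∃ a : G.X →ₗ[A] BalancedTensor B N Q, ∀ t, a (G.g t) = map A N j t := by
  obtain ⟨a, ha⟩ := h.cok_g.extVanishing _ _ _ _ h.isShortExact _ (map A N j)
  exact ⟨a, LinearMap.congr_fun ha⟩

/-- Vanishing in `P` forces `x = g t`. Then `t` dies in `N ⊗ Q`, into which `N ⊗ Y`, identified with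
`N ⊗ Coker f`, is embedded by `N ⊗ i₂`. -/
theorem eq_zero_of_cok {G : MoritaTuple A B M N} {P Q : Type u} [AddCommGroup P] [Module A P]
    [AddCommGroup Q] [Module B Q] {i₁ : G.Cok →ₗ[A] P} {i₂ : G.swap.Cok →ₗ[B] Q}
    (h₁ : Function.Injective i₁) (h₂ : Function.Injective i₂)
    {a : G.X →ₗ[A] BalancedTensor B N Q}
    (ha : ∀ t, a (G.g t) = map A N (i₂ ∘ₗ (LinearMap.range G.f).mkQ) t) {x : G.X}
    (hx : i₁ (Submodule.Quotient.mk x) = 0) (hx' : a x = 0) : x = 0 := by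
  obtain ⟨t, rfl⟩ := mk_eq_zero.1 ((injective_iff_map_eq_zero i₁).1 h₁ _ hx)
  rw [ha, ← map_map (B := A)] at hx'
  have := (injective_iff_map_eq_zero _).1 (map_injective (B := A) (M := N) h₂) _ hx'
  rw [(injective_iff_map_eq_zero _).1 G.map_mkQ_injective _ this, map_zero]

/-- Horseshoe construction: the cosyzygies `C'` and `D'` of the two cokernels become the cokernels
of the structure maps of the new quadruple. -/
theorem IsMonicGP.exists_right {G : MoritaTuple A B M N} (h : G.IsMonicGP) :
    ∃ (U G' : MoritaTuple A B M N) (i : Hom G U) (p : Hom U G'),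
      U.Perf ∧ IsSES i p ∧ G'.IsMonicGP := by
  obtain ⟨P, C', _, _, _, _, i₁, p₁, _, _, h₁, hC⟩ := h.cok_g.exists_right
  obtain ⟨Q, D', _, _, _, _, i₂, p₂, _, _, h₂, hD⟩ := h.cok_f.exists_right
  obtain ⟨a, ha⟩ := h.exists_map (i₂ ∘ₗ (LinearMap.range G.f).mkQ)
  obtain ⟨b, hb⟩ := h.swap.exists_map (i₁ ∘ₗ (LinearMap.range G.g).mkQ)
  let φ : Hom G (free A B M N P Q) :=
    { α := (i₁ ∘ₗ (LinearMap.range G.g).mkQ).prod a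
      β := b.prod (i₂ ∘ₗ (LinearMap.range G.f).mkQ)
      comm_f := fun m x => by
        refine Prod.ext (hb (tmul A m x)) ?_
        change i₂ (Submodule.Quotient.mk (G.f (tmul A m x))) = 0
        rw [G.swap.mk_g, map_zero]
      comm_g := fun n y => by
        refine Prod.ext ?_ (ha (tmul B n y))
        change i₁ (Submodule.Quotient.mk (G.g (tmul B n y))) = 0
        rw [G.mk_g, map_zero] }
  have hα : Function.Injective φ.α := by
    rw [injective_iff_map_eq_zero]
    intro x hx
    exact eq_zero_of_cok h₁.injective h₂.injective ha (congrArg Prod.fst hx)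
      (congrArg Prod.snd hx)
  have hβ : Function.Injective φ.β := by
    rw [injective_iff_map_eq_zero]
    intro y hy
    exact eq_zero_of_cok (G := G.swap) h₂.injective h₁.injective hb (congrArg Prod.snd hy)
      (congrArg Prod.fst hy)
  obtain ⟨G', p, hp⟩ := exists_cokernel φ hα hβ
  obtain ⟨hg, hcg⟩ := hp.cosyzygy h₁ (fun _ => rfl) hC
  obtain ⟨hf, hcf⟩ := hp.freeSwap_right.cosyzygy h₂ (fun _ => rfl) hD
  exact ⟨_, G', φ, p, perf_free, hp, hg, hf, hcg, hcf⟩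

/-- Surjectivity of `desc a b` on first components. Modulo `a`, the element is some `g s`, and `s`
lifts along `N ⊗ b` because `N ⊗ Y` may be replaced by `N ⊗ Coker f`. -/
theorem exists_eq_add {G : MoritaTuple A B M N} {P Q : Type u} [AddCommGroup P] [Module A P]
    [AddCommGroup Q] [Module B Q] {a : P →ₗ[A] G.X} {b : Q →ₗ[B] G.Y}
    (ha : Function.Surjective ((LinearMap.range G.g).mkQ ∘ₗ a))
    (hb : Function.Surjective ((LinearMap.range G.f).mkQ ∘ₗ b)) (x : G.X) :
    ∃ (z : P) (t : BalancedTensor B N Q), a z + G.g (map A N b t) = x := by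
  obtain ⟨z, hz⟩ := ha (Submodule.Quotient.mk x)
  obtain ⟨s, hs⟩ := (Submodule.Quotient.eq _).1 hz.symm
  obtain ⟨t, ht⟩ := map_surjective (B := A) (M := N) hb (map A N (LinearMap.range G.f).mkQ s)
  rw [← map_map (B := A)] at ht
  exact ⟨z, t, by rw [G.map_mkQ_injective ht, hs]; abel⟩

theorem Hom.α_g_eq_zero {K V : MoritaTuple A B M N} (d : Hom K V)
    (hd : ∀ y, d.β y ∈ LinearMap.range V.f) (t : BalancedTensor B N K.Y) : d.α (K.g t) = 0 := by
  rw [d.g_apply]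
  induction t using induction_on with
  | zero => simp
  | tmul n y =>
    obtain ⟨s, hs⟩ := hd y
    rw [map_tmul, ← hs, g_f]
  | add s t hs ht => simp only [map_add, hs, ht, add_zero]

/-- The correction step: `Im V.g` is finitely generated projective, being isomorphic to `N ⊗ Coker
V.f`, so a map landing there extends without leaving it. -/
theorem IsSES.exists_extension_range {K U G V : MoritaTuple A B M N} {i : Hom K U} {p : Hom U G}
    (h : IsSES i p) (hG : G.IsMonicGP) (hV : V.Perf) (d : Hom K V)
    (hα : ∀ x, d.α x ∈ LinearMap.range V.g) (hβ : ∀ y, d.β y ∈ LinearMap.range V.f) :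
    ∃ ε : U.X →ₗ[A] V.X, (∀ t, ε (U.g t) = 0) ∧ (∀ x, ε (i.α x) = d.α x) ∧
      ∀ x, ∃ t, V.g t = ε x := by
  have := hV.range_finite
  have := hV.range_projective
  obtain ⟨ε, h1, h2⟩ := h.exists_extension hG.injective_g hG.cok_g.extVanishing
    (d.α.codRestrict _ hα) (fun t => Subtype.ext (Hom.α_g_eq_zero d hβ t))
  exact ⟨Submodule.subtype _ ∘ₗ ε, fun t => congrArg Subtype.val (h1 t),
    fun x => congrArg Subtype.val (h2 x), fun x => (ε x).2⟩

/-- The approximation step: the map is extended only modulo `Im V.g`, where `V.Cok` is projective,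
and the result is then lifted on the generating summand `P`. -/
theorem IsSES.exists_lift {K U G V : MoritaTuple A B M N} {i : Hom K U} {p : Hom U G}
    (h : IsSES i p) (hG : G.IsMonicGP) (hV : V.Perf) (d : Hom K V)
    {P : Type u} [AddCommGroup P] [Module A P] [Module.Projective A P] (j : P →ₗ[A] U.X) :
    ∃ (ε : U.X →ₗ[A] V.Cok) (a : P →ₗ[A] V.X), (∀ t, ε (U.g t) = 0) ∧
      (∀ x, ε (i.α x) = Submodule.Quotient.mk (d.α x)) ∧
      ∀ x, Submodule.Quotient.mk (a x) = ε (j x) := by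
  have := hV.cok_finite
  have := hV.cok_projective
  obtain ⟨ε, h1, h2⟩ := h.exists_extension hG.injective_g hG.cok_g.extVanishing
    ((LinearMap.range V.g).mkQ ∘ₗ d.α) (fun t => by
      rw [LinearMap.comp_apply, d.g_apply]; exact mk_g _ _)
  obtain ⟨a, ha⟩ := Module.projective_lifting_property (LinearMap.range V.g).mkQ (ε ∘ₗ j)
    (Submodule.mkQ_surjective _)
  exact ⟨ε, a, h1, h2, LinearMap.congr_fun ha⟩

theorem IsSES.exists_hom_extension {K G V : MoritaTuple A B M N}
    {P Q : Type u} [AddCommGroup P] [Module A P] [AddCommGroup Q] [Module B Q]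
    [Module.Projective A P] [Module.Projective B Q]
    {i : Hom K (free A B M N P Q)} {p : Hom (free A B M N P Q) G}
    (h : IsSES i p) (hG : G.IsMonicGP) (hV : V.Perf) (φ : Hom K V) :
    ∃ k : Hom (free A B M N P Q) V, (∀ x, k.α (i.α x) = φ.α x) ∧ ∀ y, k.β (i.β y) = φ.β y := by
  obtain ⟨ε, a, h1, h2, h3⟩ := h.exists_lift hG hV φ (LinearMap.inl A P (BalancedTensor B N Q))
  obtain ⟨η, b, h1', h2', h3'⟩ := h.swap.exists_lift hG.swap hV.swap φ.swap
    (LinearMap.inr B (BalancedTensor A M P) Q)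
  -- `k` extends `φ` up to errors in `Im V.g` and `Im V.f`.
  let k := V.desc a b
  have hk (x) : Submodule.Quotient.mk (k.α x) = ε x := by
    obtain ⟨x, t⟩ := x
    obtain ⟨s, hs⟩ := map_surjective (B := A) (M := N)
      (h := LinearMap.snd B (BalancedTensor A M P) Q) Prod.snd_surjective t
    -- The second coordinate lies in the image of `g`, so it is invisible to `ε` and modulo `Im
    -- V.g`.
    have e1 : ((x, t) : P × BalancedTensor B N Q) = (x, 0) + (free A B M N P Q).g s :=
      Prod.ext (add_zero x).symm (by rw [← hs]; exact (zero_add _).symm)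
    have e2 : ε (x, t) = ε (x, 0) := by
      rw [e1, map_add, h1, add_zero]
    rw [e2, desc_α, Submodule.Quotient.mk_add, mk_g, add_zero]
    exact h3 x
  have hk' (y) : (Submodule.Quotient.mk (k.β y) : V.swap.Cok) = η y := by
    obtain ⟨t, y⟩ := y
    obtain ⟨s, hs⟩ := map_surjective (B := B) (M := M)
      (h := LinearMap.fst A P (BalancedTensor B N Q)) Prod.fst_surjective t
    have e1 : ((t, y) : BalancedTensor A M P × Q) = (0, y) + (free A B M N P Q).f s :=
      Prod.ext (by rw [← hs]; exact (zero_add _).symm) (add_zero y).symm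
    have e2 : η (t, y) = η (0, y) := by
      rw [e1, map_add, h1', add_zero]
    rw [e2, desc_β, Submodule.Quotient.mk_add, V.swap.mk_g, zero_add]
    exact h3' y
  let d := k.comp i - φ
  have hα (x) : d.α x ∈ LinearMap.range V.g :=
    (Submodule.Quotient.eq _).1 ((hk (i.α x)).trans (h2 x))
  have hβ (y) : d.β y ∈ LinearMap.range V.f :=
    (Submodule.Quotient.eq _).1 ((hk' (i.β y)).trans (h2' y))
  obtain ⟨ε', e1, e2, e3⟩ := h.exists_extension_range hG hV d hα hβ
  obtain ⟨η', e1', e2', e3'⟩ := h.swap.exists_extension_range hG.swap hV.swap d.swap hβ hα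
  -- Both sides of each compatibility vanish: `ε'` and `η'` kill the images of the structure maps,
  -- and take values in the images of those of `V`, on which the other structure map is zero.
  let e : Hom (free A B M N P Q) V :=
    { α := ε'
      β := η'
      comm_f := fun m x => by
        obtain ⟨t, ht⟩ := e3 x
        exact (e1' _).trans (by rw [← ht]; exact (V.swap.g_f m t).symm)
      comm_g := fun n y => by
        obtain ⟨t, ht⟩ := e3' y
        exact (e1 _).trans (by rw [← ht]; exact (V.g_f n t).symm) }
  refine ⟨k - e, fun x => ?_, fun y => ?_⟩
  · change k.α (i.α x) - ε' (i.α x) = _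
    rw [e2]
    exact sub_sub_cancel _ _
  · change k.β (i.β y) - η' (i.β y) = _
    rw [e2']
    exact sub_sub_cancel _ _

/-- The left half covers `free P Q ⟶ G` by lifting projective covers `p₁`, `p₂` of the two cokernels
to `X` and `Y`; the syzygies `C'`, `D'` then are the cokernels for the kernel quadruple. -/
theorem isResolvingClass_isMonicGP :
    IsResolvingClass (IsMonicGP : MoritaTuple A B M N → Prop) where
  right _ h := h.exists_right
  left G h := by
    obtain ⟨C', P, _, _, _, _, i₁, p₁, _, _, h₁, hC, -⟩ := h.cok_g.exists_left
    obtain ⟨D', Q, _, _, _, _, i₂, p₂, _, _, h₂, hD, -⟩ := h.cok_f.exists_left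
    obtain ⟨a, ha⟩ := Module.projective_lifting_property (LinearMap.range G.g).mkQ p₁
      (Submodule.mkQ_surjective _)
    obtain ⟨b, hb⟩ := Module.projective_lifting_property (LinearMap.range G.f).mkQ p₂
      (Submodule.mkQ_surjective _)
    have ha' : Function.Surjective ((LinearMap.range G.g).mkQ ∘ₗ a) := by
      rw [ha]; exact h₁.surjective
    have hb' : Function.Surjective ((LinearMap.range G.f).mkQ ∘ₗ b) := by
      rw [hb]; exact h₂.surjective
    obtain ⟨K, i, hi⟩ := exists_kernel (G.desc a b)
      (fun x => by
        obtain ⟨z, t, e⟩ := exists_eq_add ha' hb' x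
        exact ⟨(z, t), e⟩)
      (fun y => by
        obtain ⟨z, t, e⟩ := exists_eq_add (G := G.swap) hb' ha' y
        exact ⟨(t, z), (add_comm _ _).trans e⟩)
    obtain ⟨hg, hcg⟩ := hi.syzygy h.injective_g h₁ (fun x => by
      rw [desc_α, map_zero, map_zero, add_zero]
      exact LinearMap.congr_fun ha x) hC
    obtain ⟨hf, hcf⟩ := hi.freeSwap_right.syzygy h.injective_f h₂ (fun y => by
      refine Eq.trans ?_ (LinearMap.congr_fun hb y)
      change Submodule.Quotient.mk (G.f (map B M a 0) + b y) = _
      rw [map_zero, map_zero, zero_add]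
      rfl) hD
    exact ⟨K, _, i, _, perf_free, hi, ⟨hg, hf, hcg, hcf⟩,
      fun V hV φ => hi.exists_hom_extension h hV φ⟩

end MoritaTuple

end MoritaTuple

/-! ### Peirce decomposition: every module over the Morita ring is a quadruple. -/

section MoritaTuple

open BalancedTensor

variable {A B M N : Type u} [Ring A] [Ring B]
variable [AddCommGroup M] [Module B M] [Module Aᵐᵒᵖ M] [SMulCommClass B Aᵐᵒᵖ M]
variable [AddCommGroup N] [Module A N] [Module Bᵐᵒᵖ N] [SMulCommClass A Bᵐᵒᵖ N]

namespace MoritaRing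

variable (C : MoritaDatum A B M N)

/-- The matrix with upper left entry `a`. -/
def ofA (a : A) : MoritaRing C := ⟨a, 0, 0, 0⟩
/-- The matrix with upper right entry `n`. -/
def ofN (n : N) : MoritaRing C := ⟨0, n, 0, 0⟩
/-- The matrix with lower left entry `m`. -/
def ofM (m : M) : MoritaRing C := ⟨0, 0, m, 0⟩
/-- The matrix with lower right entry `b`. -/
def ofB (b : B) : MoritaRing C := ⟨0, 0, 0, b⟩

theorem eq_sum (s : MoritaRing C) : s = ofA C s.a + ofN C s.n + ofM C s.m + ofB C s.b := by
  ext <;> simp [ofA, ofN, ofM, ofB]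

theorem ofA_add (a a' : A) : ofA C (a + a') = ofA C a + ofA C a' := by ext <;> simp [ofA]
theorem ofB_add (a a' : B) : ofB C (a + a') = ofB C a + ofB C a' := by ext <;> simp [ofB]
theorem ofM_add (a a' : M) : ofM C (a + a') = ofM C a + ofM C a' := by ext <;> simp [ofM]
theorem ofN_add (a a' : N) : ofN C (a + a') = ofN C a + ofN C a' := by ext <;> simp [ofN]
theorem ofA_mul (a a' : A) : ofA C (a * a') = ofA C a * ofA C a' := by
  ext <;> simp [ofA, zero_tmul]
theorem ofB_mul (a a' : B) : ofB C (a * a') = ofB C a * ofB C a' := by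
  ext <;> simp [ofB, zero_tmul]
theorem ofA_mul_ofN (a : A) (n : N) : ofA C a * ofN C n = ofN C (a • n) := by
  ext <;> simp [ofA, ofN, zero_tmul]
theorem ofB_mul_ofM (b : B) (m : M) : ofB C b * ofM C m = ofM C (b • m) := by
  ext <;> simp [ofB, ofM, zero_tmul]
theorem ofM_mul_ofA (a : A) (m : M) : ofM C m * ofA C a = ofM C (op a • m) := by
  ext <;> simp [ofA, ofM, tmul_zero]
theorem ofN_mul_ofB (b : B) (n : N) : ofN C n * ofB C b = ofN C (op b • n) := by
  ext <;> simp [ofB, ofN, tmul_zero]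
theorem ofB_mul_ofA (a : A) (b : B) : ofB C b * ofA C a = 0 := by
  ext <;> simp [ofB, ofA, zero_tmul]
theorem ofA_mul_ofB (a : A) (b : B) : ofA C a * ofB C b = 0 := by
  ext <;> simp [ofB, ofA, zero_tmul]
theorem ofN_mul_ofA (a : A) (n : N) : ofN C n * ofA C a = 0 := by
  ext <;> simp [ofN, ofA, tmul_zero]
theorem ofM_mul_ofB (b : B) (m : M) : ofM C m * ofB C b = 0 := by
  ext <;> simp [ofM, ofB, tmul_zero]
theorem one_eq : (1 : MoritaRing C) = ofA C 1 + ofB C 1 := by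
  ext <;> simp [ofA, ofB]

variable (Z : Type u) [AddCommGroup Z] [Module (MoritaRing C) Z]

/-- The first component of a module over a Morita ring. -/
def fstPart : AddSubgroup Z where
  carrier := {z | ofA C 1 • z = z}
  add_mem' {z w} hz hw := by
    change ofA C 1 • (z + w) = z + w
    rw [smul_add, hz, hw]
  zero_mem' := smul_zero _
  neg_mem' {z} hz := by
    change ofA C 1 • (-z) = -z
    rw [smul_neg, hz]

/-- The second component of a module over a Morita ring. -/
def sndPart : AddSubgroup Z where
  carrier := {z | ofB C 1 • z = z}
  add_mem' {z w} hz hw := by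
    change ofB C 1 • (z + w) = z + w
    rw [smul_add, hz, hw]
  zero_mem' := smul_zero _
  neg_mem' {z} hz := by
    change ofB C 1 • (-z) = -z
    rw [smul_neg, hz]

variable {Z}

theorem ofA_smul_mem (a : A) (z : Z) : ofA C a • z ∈ fstPart C Z := by
  change ofA C 1 • ofA C a • z = _
  rw [smul_smul, ← ofA_mul, one_mul]

theorem ofN_smul_mem (n : N) (z : Z) : ofN C n • z ∈ fstPart C Z := by
  change ofA C 1 • ofN C n • z = _
  rw [smul_smul, ofA_mul_ofN, one_smul]

theorem ofB_smul_mem (b : B) (z : Z) : ofB C b • z ∈ sndPart C Z := by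
  change ofB C 1 • ofB C b • z = _
  rw [smul_smul, ← ofB_mul, one_mul]

theorem ofM_smul_mem (m : M) (z : Z) : ofM C m • z ∈ sndPart C Z := by
  change ofB C 1 • ofM C m • z = _
  rw [smul_smul, ofB_mul_ofM, one_smul]

/-- `ofA` is not unital, so `Z` itself is not an `A`-module through it; on `fstPart` the idempotent
`ofA C 1` acts as the identity by definition. -/
instance : Module A (fstPart C Z) where
  smul a z := ⟨ofA C a • (z : Z), ofA_smul_mem C a _⟩
  one_smul z := Subtype.ext z.2
  mul_smul a a' z := Subtype.ext (by
    change ofA C (a * a') • (z : Z) = ofA C a • ofA C a' • (z : Z)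
    rw [ofA_mul, mul_smul])
  smul_zero a := Subtype.ext (smul_zero _)
  smul_add a z w := Subtype.ext (smul_add _ _ _)
  add_smul a a' z := Subtype.ext (by
    change ofA C (a + a') • (z : Z) = ofA C a • (z : Z) + ofA C a' • (z : Z)
    rw [ofA_add, add_smul])
  zero_smul z := Subtype.ext (zero_smul (MoritaRing C) (z : Z))

instance : Module B (sndPart C Z) where
  smul a z := ⟨ofB C a • (z : Z), ofB_smul_mem C a _⟩
  one_smul z := Subtype.ext z.2
  mul_smul a a' z := Subtype.ext (by
    change ofB C (a * a') • (z : Z) = ofB C a • ofB C a' • (z : Z)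
    rw [ofB_mul, mul_smul])
  smul_zero a := Subtype.ext (smul_zero _)
  smul_add a z w := Subtype.ext (smul_add _ _ _)
  add_smul a a' z := Subtype.ext (by
    change ofB C (a + a') • (z : Z) = ofB C a • (z : Z) + ofB C a' • (z : Z)
    rw [ofB_add, add_smul])
  zero_smul z := Subtype.ext (zero_smul (MoritaRing C) (z : Z))

variable (Z) in
/-- The quadruple of a module over a Morita ring. -/
def toTuple : MoritaTuple A B M N where
  X := fstPart C Z
  Y := sndPart C Z
  f := liftLinear
    (AddMonoidHom.mk' (fun m => AddMonoidHom.mk'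
      (fun x => (⟨ofM C m • (x : Z), ofM_smul_mem C m _⟩ : sndPart C Z))
      (fun x x' => Subtype.ext (smul_add _ _ _)))
      (fun m m' => by
        ext x
        change ofM C (m + m') • (x : Z) = ofM C m • (x : Z) + ofM C m' • (x : Z)
        rw [ofM_add, add_smul]))
    (fun m a x => Subtype.ext (by
      change ofM C (op a • m) • (x : Z) = ofM C m • ofA C a • (x : Z)
      rw [← ofM_mul_ofA, mul_smul]))
    (fun b m x => Subtype.ext (by
      change ofM C (b • m) • (x : Z) = ofB C b • ofM C m • (x : Z)
      rw [← ofB_mul_ofM, mul_smul]))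
  g := liftLinear
    (AddMonoidHom.mk' (fun n => AddMonoidHom.mk'
      (fun x => (⟨ofN C n • (x : Z), ofN_smul_mem C n _⟩ : fstPart C Z))
      (fun x x' => Subtype.ext (smul_add _ _ _)))
      (fun m m' => by
        ext x
        change ofN C (m + m') • (x : Z) = ofN C m • (x : Z) + ofN C m' • (x : Z)
        rw [ofN_add, add_smul]))
    (fun m a x => Subtype.ext (by
      change ofN C (op a • m) • (x : Z) = ofN C m • ofB C a • (x : Z)
      rw [← ofN_mul_ofB, mul_smul]))
    (fun b m x => Subtype.ext (by
      change ofN C (b • m) • (x : Z) = ofA C b • ofN C m • (x : Z)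
      rw [← ofA_mul_ofN, mul_smul]))

/-- The inclusion of the first component. -/
def fstVal : (toTuple C Z).X →+ Z := (fstPart C Z).subtype

/-- The inclusion of the second component. -/
def sndVal : (toTuple C Z).Y →+ Z := (sndPart C Z).subtype

theorem ofA_smul_fstVal (x : (toTuple C Z).X) : ofA C 1 • fstVal C x = fstVal C x :=
  Subtype.property (p := (· ∈ fstPart C Z)) x

theorem ofB_smul_sndVal (y : (toTuple C Z).Y) : ofB C 1 • sndVal C y = sndVal C y :=
  Subtype.property (p := (· ∈ sndPart C Z)) y

theorem smul_fstVal (s : MoritaRing C) (x : (toTuple C Z).X) :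
    s • fstVal C x = ofA C s.a • fstVal C x + ofM C s.m • fstVal C x := by
  have hx := ofA_smul_fstVal C x
  conv_lhs => rw [eq_sum C s, add_smul, add_smul, add_smul]
  have h1 : ofN C s.n • fstVal C x = 0 := by rw [← hx, smul_smul, ofN_mul_ofA, zero_smul]
  have h2 : ofB C s.b • fstVal C x = 0 := by rw [← hx, smul_smul, ofB_mul_ofA, zero_smul]
  rw [h1, h2, add_zero, add_zero]

theorem smul_sndVal (s : MoritaRing C) (y : (toTuple C Z).Y) :
    s • sndVal C y = ofN C s.n • sndVal C y + ofB C s.b • sndVal C y := by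
  have hy := ofB_smul_sndVal C y
  conv_lhs => rw [eq_sum C s, add_smul, add_smul, add_smul]
  have h1 : ofM C s.m • sndVal C y = 0 := by rw [← hy, smul_smul, ofM_mul_ofB, zero_smul]
  have h2 : ofA C s.a • sndVal C y = 0 := by rw [← hy, smul_smul, ofA_mul_ofB, zero_smul]
  rw [h1, h2, add_zero, zero_add]

variable [Subsingleton (BalancedTensor A M N)] [Subsingleton (BalancedTensor B N M)]

/-- The comparison map from the module of the quadruple of `Z` to `Z`. -/
def fromTuple : MoritaModule C (toTuple C Z).f (toTuple C Z).g →ₗ[MoritaRing C] Z where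
  toFun v := fstVal C v.1 + sndVal C v.2
  map_add' v w := by
    rw [MoritaModule.add_fst, MoritaModule.add_snd, map_add, map_add]
    abel
  map_smul' s v := by
    change (ofA C s.a • fstVal C v.1 + ofN C s.n • sndVal C v.2) +
      (ofM C s.m • fstVal C v.1 + ofB C s.b • sndVal C v.2) =
      s • (fstVal C v.1 + sndVal C v.2)
    rw [smul_add, smul_fstVal C s v.1, smul_sndVal C s v.2]
    abel

theorem fromTuple_bijective : Function.Bijective (fromTuple C (Z := Z)) := by
  constructor
  · rw [injective_iff_map_eq_zero]
    rintro ⟨x, y⟩ h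
    have hx := ofA_smul_fstVal C x
    have hy := ofB_smul_sndVal C y
    have h : fstVal C x + sndVal C y = 0 := h
    have h1 := congrArg (fun z => ofA C 1 • z) h
    have h2 := congrArg (fun z => ofB C 1 • z) h
    simp only [smul_zero, smul_add] at h1 h2
    rw [hx, ← hy, smul_smul, ofA_mul_ofB, zero_smul, add_zero] at h1
    rw [hy, ← hx, smul_smul, ofB_mul_ofA, zero_smul, zero_add] at h2
    exact Prod.ext (Subtype.ext h1) (Subtype.ext h2)
  · intro z
    let x : (toTuple C Z).X := (⟨ofA C 1 • z, ofA_smul_mem C 1 z⟩ : fstPart C Z)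
    let y : (toTuple C Z).Y := (⟨ofB C 1 • z, ofB_smul_mem C 1 z⟩ : sndPart C Z)
    refine ⟨((x, y) : (toTuple C Z).X × (toTuple C Z).Y), ?_⟩
    change ofA C 1 • z + ofB C 1 • z = z
    rw [← add_smul, ← one_eq, one_smul]

variable (Z) in
/-- Every module over the Morita ring is given by a quadruple. -/
noncomputable def tupleEquiv :
    MoritaModule C (toTuple C Z).f (toTuple C Z).g ≃ₗ[MoritaRing C] Z :=
  LinearEquiv.ofBijective (fromTuple C) (fromTuple_bijective C)

end MoritaRing

/-! ### Translation of maps, exactness and projectivity between quadruples and modules. -/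

namespace MoritaTuple

variable (C : MoritaDatum A B M N)

/-- The module over the Morita ring given by a quadruple. -/
abbrev toModule (G : MoritaTuple A B M N) : Type u := MoritaModule C G.f G.g

/-- The element with components `x` and `y`. -/
def pair (G : MoritaTuple A B M N) (x : G.X) (y : G.Y) : G.toModule C := (x, y)

variable [Subsingleton (BalancedTensor A M N)] [Subsingleton (BalancedTensor B N M)]
variable {G H K : MoritaTuple A B M N}

/-- The linear map of a morphism of quadruples. -/
def Hom.toLin (φ : Hom G H) : G.toModule C →ₗ[MoritaRing C] H.toModule C where
  toFun v := (φ.α v.1, φ.β v.2)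
  map_add' v w := Prod.ext (map_add φ.α _ _) (map_add φ.β _ _)
  map_smul' s v := by
    refine Prod.ext ?_ ?_
    · change φ.α (s.a • v.1 + G.g (tmul B s.n v.2)) = s.a • φ.α v.1 + H.g (tmul B s.n (φ.β v.2))
      rw [map_add, map_smul, φ.comm_g]
    · change φ.β (G.f (tmul A s.m v.1) + s.b • v.2) = H.f (tmul A s.m (φ.α v.1)) + s.b • φ.β v.2
      rw [map_add, map_smul, φ.comm_f]

theorem smul_def (s : MoritaRing C) (x : G.X) (y : G.Y) :
    (s • G.pair C x y : G.toModule C) =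
      G.pair C (s.a • x + G.g (tmul B s.n y)) (G.f (tmul A s.m x) + s.b • y) := rfl

theorem ofA_smul (a : A) (x : G.X) (y : G.Y) :
    (MoritaRing.ofA C a • G.pair C x y : G.toModule C) =
      G.pair C (a • x) 0 := by
  rw [smul_def]
  simp [MoritaRing.ofA, zero_tmul]

theorem ofB_smul (b : B) (x : G.X) (y : G.Y) :
    (MoritaRing.ofB C b • G.pair C x y : G.toModule C) =
      G.pair C 0 (b • y) := by
  rw [smul_def]
  simp [MoritaRing.ofB, zero_tmul]

theorem ofN_smul (n : N) (x : G.X) (y : G.Y) :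
    (MoritaRing.ofN C n • G.pair C x y : G.toModule C) =
      G.pair C (G.g (tmul B n y)) 0 := by
  rw [smul_def]
  simp [MoritaRing.ofN, zero_tmul]

theorem ofM_smul (m : M) (x : G.X) (y : G.Y) :
    (MoritaRing.ofM C m • G.pair C x y : G.toModule C) =
      G.pair C 0 (G.f (tmul A m x)) := by
  rw [smul_def]
  simp [MoritaRing.ofM, zero_tmul]

variable {C}

/-- Linearity over the two idempotents makes `θ` preserve the components; linearity over `ofM` and
`ofN` gives compatibility with `f` and `g`. -/
theorem exists_toLin_eq (θ : G.toModule C →ₗ[MoritaRing C] H.toModule C) :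
    ∃ φ : Hom G H, φ.toLin C = θ := by
  have h1 (x : G.X) : θ (G.pair C x 0) =
      H.pair C (θ (G.pair C x 0)).1 0 := by
    have e := ofA_smul C (1 : A) x (0 : G.Y)
    rw [one_smul] at e
    conv_lhs => rw [← e, map_smul]
    exact (ofA_smul C _ _ _).trans (congrArg (fun z => H.pair C z 0) (one_smul A _))
  have h2 (y : G.Y) : θ (G.pair C 0 y) =
      H.pair C 0 (θ (G.pair C 0 y)).2 := by
    have e := ofB_smul C (1 : B) (0 : G.X) y
    rw [one_smul] at e
    conv_lhs => rw [← e, map_smul]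
    exact (ofB_smul C _ _ _).trans (congrArg (fun z => H.pair C 0 z) (one_smul B _))
  let φ : Hom G H :=
    { α :=
        { toFun := fun x => (θ (G.pair C x 0)).1
          map_add' := fun x x' => by
            have e : (G.pair C (x + x') 0) =
              G.pair C x 0 + G.pair C x' 0 :=
              Prod.ext rfl (add_zero 0).symm
            rw [e, map_add]; rfl
          map_smul' := fun a x => by
            have e := ofA_smul C a x (0 : G.Y)
            rw [← e, map_smul]
            exact congrArg Prod.fst (ofA_smul C a _ _) }
      β :=
        { toFun := fun y => (θ (G.pair C 0 y)).2
          map_add' := fun x x' => by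
            have e : (G.pair C 0 (x + x')) =
              G.pair C 0 x + G.pair C 0 x' :=
              Prod.ext (add_zero 0).symm rfl
            rw [e, map_add]; rfl
          map_smul' := fun b y => by
            have e := ofB_smul C b (0 : G.X) y
            rw [← e, map_smul]
            exact congrArg Prod.snd (ofB_smul C b _ _) }
      comm_f := fun m x => by
        have e := ofM_smul C m x (0 : G.Y)
        change (θ (G.pair C 0 (G.f (tmul A m x)))).2 = _
        rw [← e, map_smul]
        exact congrArg Prod.snd (ofM_smul C m _ _)
      comm_g := fun n y => by
        have e := ofN_smul C n (0 : G.X) y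
        change (θ (G.pair C (G.g (tmul B n y)) 0)).1 = _
        rw [← e, map_smul]
        exact congrArg Prod.fst (ofN_smul C n _ _) }
  refine ⟨φ, LinearMap.ext fun v => ?_⟩
  have e : v = G.pair C v.1 0 + G.pair C 0 v.2 :=
    Prod.ext (add_zero _).symm (zero_add _).symm
  conv_rhs => rw [e, map_add, h1, h2]
  exact Prod.ext (add_zero _).symm (zero_add _).symm

theorem isShortExact_toLin_iff {i : Hom K H} {p : Hom H G} :
    IsShortExact (i.toLin C) (p.toLin C) ↔ IsSES i p := by
  constructor
  · intro h
    refine ⟨⟨?_, ?_, ?_⟩, ⟨?_, ?_, ?_⟩⟩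
    · intro x x' e
      exact congrArg Prod.fst (h.injective (a₁ := (K.pair C x 0))
        (a₂ := (K.pair C x' 0)) (Prod.ext e rfl))
    · intro x
      constructor
      · intro e
        obtain ⟨v, hv⟩ := (h.exact (H.pair C x 0)).1 (Prod.ext e (map_zero p.β))
        exact ⟨v.1, congrArg Prod.fst hv⟩
      · rintro ⟨v, rfl⟩
        exact congrArg Prod.fst ((h.exact _).2 ⟨(K.pair C v 0), rfl⟩)
    · intro x
      obtain ⟨v, hv⟩ := h.surjective (G.pair C x 0)
      exact ⟨v.1, congrArg Prod.fst hv⟩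
    · intro x x' e
      exact congrArg Prod.snd (h.injective (a₁ := (K.pair C 0 x))
        (a₂ := (K.pair C 0 x')) (Prod.ext rfl e))
    · intro x
      constructor
      · intro e
        obtain ⟨v, hv⟩ := (h.exact (H.pair C 0 x)).1 (Prod.ext (map_zero p.α) e)
        exact ⟨v.2, congrArg Prod.snd hv⟩
      · rintro ⟨v, rfl⟩
        exact congrArg Prod.snd ((h.exact _).2 ⟨(K.pair C 0 v), rfl⟩)
    · intro x
      obtain ⟨v, hv⟩ := h.surjective (G.pair C 0 x)
      exact ⟨v.2, congrArg Prod.snd hv⟩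
  · intro h
    refine ⟨?_, ?_, ?_⟩
    · intro v w e
      exact Prod.ext (h.fst.injective (congrArg Prod.fst e))
        (h.snd.injective (congrArg Prod.snd e))
    · intro v
      constructor
      · intro e
        obtain ⟨x, hx⟩ := (h.fst.exact v.1).1 (congrArg Prod.fst e)
        obtain ⟨y, hy⟩ := (h.snd.exact v.2).1 (congrArg Prod.snd e)
        exact ⟨(K.pair C x y), Prod.ext hx hy⟩
      · rintro ⟨v, rfl⟩
        exact Prod.ext ((h.fst.exact _).2 ⟨v.1, rfl⟩) ((h.snd.exact _).2 ⟨v.2, rfl⟩)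
    · intro v
      obtain ⟨x, hx⟩ := h.fst.surjective v.1
      obtain ⟨y, hy⟩ := h.snd.surjective v.2
      exact ⟨(H.pair C x y), Prod.ext hx hy⟩

variable [Module.Finite B M] [Module.Finite Aᵐᵒᵖ M] [Module.Finite A N] [Module.Finite Bᵐᵒᵖ N]
variable [Module.Projective B M] [Module.Projective Aᵐᵒᵖ M] [Module.Projective A N]
  [Module.Projective Bᵐᵒᵖ N]

/-- The components of `n` generators define a surjection from `free Aⁿ Bⁿ`, and projectivity splits
it. -/
theorem perf_of_projective {U : MoritaTuple A B M N} [Module.Finite (MoritaRing C) (U.toModule C)]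
    [Module.Projective (MoritaRing C) (U.toModule C)] : U.Perf := by
  obtain ⟨n, v, hv⟩ := Module.Finite.exists_fin (R := MoritaRing C) (M := U.toModule C)
  let r : Hom (free A B M N (Fin n → A) (Fin n → B)) U :=
    U.desc (Fintype.linearCombination A fun i => (v i).1)
      (Fintype.linearCombination B fun i => (v i).2)
  have hr : Function.Surjective (r.toLin C) := by
    rw [← LinearMap.range_eq_top, eq_top_iff, ← hv, Submodule.span_le]
    rintro _ ⟨i, rfl⟩
    refine ⟨(((Pi.single i 1, 0), (0, Pi.single i 1)) :
      ((Fin n → A) × BalancedTensor B N (Fin n → B)) ×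
      (BalancedTensor A M (Fin n → A) × (Fin n → B))), Prod.ext ?_ ?_⟩
    · change r.α (Pi.single i 1, 0) = (v i).1
      rw [desc_α, map_zero, map_zero, add_zero, Fintype.linearCombination_apply_single, one_smul]
    · change r.β (0, Pi.single i 1) = (v i).2
      rw [desc_β, map_zero, map_zero, zero_add, Fintype.linearCombination_apply_single, one_smul]
  obtain ⟨s, hs⟩ := Module.projective_lifting_property (r.toLin C) LinearMap.id hr
  obtain ⟨σ, rfl⟩ := exists_toLin_eq s
  exact ⟨_, _, _, _, _, _, inferInstance, inferInstance, inferInstance, inferInstance, σ, r,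
    fun x => congrArg Prod.fst (LinearMap.congr_fun hs (U.pair C x 0)),
    fun y => congrArg Prod.snd (LinearMap.congr_fun hs (U.pair C 0 y))⟩

theorem finite_toModule (G : MoritaTuple A B M N) [Module.Finite A G.X] [Module.Finite B G.Y] :
    Module.Finite (MoritaRing C) (G.toModule C) := by
  obtain ⟨k, v, hv⟩ := Module.Finite.exists_fin (R := A) (M := G.X)
  obtain ⟨l, w, hw⟩ := Module.Finite.exists_fin (R := B) (M := G.Y)
  let S : Submodule (MoritaRing C) (G.toModule C) := Submodule.span _
    (Set.range (fun i => (G.pair C (v i) 0)) ∪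
      Set.range (fun i => (G.pair C 0 (w i))))
  have hX (x : G.X) : (G.pair C x 0) ∈ S := by
    have hx : x ∈ Submodule.span A (Set.range v) := hv ▸ Submodule.mem_top
    induction hx using Submodule.span_induction with
    | mem x hx =>
      obtain ⟨i, rfl⟩ := hx
      exact Submodule.subset_span (Or.inl ⟨i, rfl⟩)
    | zero => exact S.zero_mem
    | add x y _ _ hx hy =>
      have e := S.add_mem hx hy
      have e' : G.pair C x 0 + G.pair C y 0 =
        (G.pair C (x + y) 0) := Prod.ext rfl (add_zero 0)
      rwa [e'] at e
    | smul a x _ hx =>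
      rw [← ofA_smul C a x 0]
      exact S.smul_mem _ hx
  have hY (y : G.Y) : (G.pair C 0 y) ∈ S := by
    have hx : y ∈ Submodule.span B (Set.range w) := hw ▸ Submodule.mem_top
    induction hx using Submodule.span_induction with
    | mem x hx =>
      obtain ⟨i, rfl⟩ := hx
      exact Submodule.subset_span (Or.inr ⟨i, rfl⟩)
    | zero => exact S.zero_mem
    | add x y _ _ hx hy =>
      have e := S.add_mem hx hy
      have e' : G.pair C 0 x + G.pair C 0 y =
        (G.pair C 0 (x + y)) := Prod.ext (add_zero 0) rfl
      rwa [e'] at e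
    | smul b x _ hx =>
      rw [← ofB_smul C b 0 x]
      exact S.smul_mem _ hx
  suffices h : S = ⊤ from
    ⟨Submodule.fg_def.2 ⟨_, (Set.finite_range _).union (Set.finite_range _), h⟩⟩
  refine eq_top_iff.2 fun u _ => ?_
  have e : G.pair C u.1 0 + G.pair C 0 u.2 = u :=
    Prod.ext (add_zero _) (zero_add _)
  rw [← e]
  exact S.add_mem (hX _) (hY _)

/-- By the universal property `desc`, lifting a morphism out of `free P Q` amounts to lifting two
maps out of `P` and `Q`. It suffices to split surjections from one large free module, viewed as a
quadruple by `tupleEquiv`. -/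
theorem projective_free {P Q : Type u} [AddCommGroup P] [Module A P] [AddCommGroup Q] [Module B Q]
    [Module.Projective A P] [Module.Projective B Q] :
    Module.Projective (MoritaRing C) ((free A B M N P Q).toModule C) := by
  refine Module.Projective.of_lifting_property'' fun q hq => ?_
  let e := MoritaRing.tupleEquiv C ((free A B M N P Q).toModule C →₀ MoritaRing C)
  obtain ⟨τ, hτ⟩ := exists_toLin_eq (q ∘ₗ e.toLinearMap)
  have hs : Function.Surjective (τ.toLin C) := by
    rw [hτ]; exact hq.comp e.surjective
  have hα : Function.Surjective τ.α := fun x => by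
    obtain ⟨v, hv⟩ := hs (pair C _ x 0)
    exact ⟨v.1, congrArg Prod.fst hv⟩
  have hβ : Function.Surjective τ.β := fun x => by
    obtain ⟨v, hv⟩ := hs (pair C _ 0 x)
    exact ⟨v.2, congrArg Prod.snd hv⟩
  obtain ⟨a, ha⟩ := Module.projective_lifting_property τ.α
    (LinearMap.inl A P (BalancedTensor B N Q)) hα
  obtain ⟨b, hb⟩ := Module.projective_lifting_property τ.β
    (LinearMap.inr B (BalancedTensor A M P) Q) hβ
  let σ := (MoritaRing.toTuple C ((free A B M N P Q).toModule C →₀ MoritaRing C)).desc a b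
  have h1 (x) : τ.α (σ.α x) = x := by
    obtain ⟨x, t⟩ := x
    rw [desc_α, map_add, τ.g_apply, map_map, hb]
    refine (congrArg₂ (· + ·) (LinearMap.congr_fun ha x) rfl).trans (Prod.ext (add_zero x) ?_)
    refine (zero_add _).trans ((map_map (B := A) _ _ _).trans ?_)
    exact map_id t
  have h2 (y) : τ.β (σ.β y) = y := by
    obtain ⟨t, y⟩ := y
    rw [desc_β, map_add, τ.swap.g_apply, map_map, ha]
    refine (congrArg₂ (· + ·) rfl (LinearMap.congr_fun hb y)).trans (Prod.ext ?_ (zero_add y))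
    refine (add_zero _).trans ((map_map (B := B) _ _ _).trans ?_)
    exact map_id t
  refine ⟨e.toLinearMap ∘ₗ σ.toLin C, ?_⟩
  rw [← LinearMap.comp_assoc, ← hτ]
  exact LinearMap.ext fun v => Prod.ext (h1 v.1) (h2 v.2)

theorem Perf.projective_and_finite {U : MoritaTuple A B M N} (h : U.Perf) :
    Module.Projective (MoritaRing C) (U.toModule C) ∧
      Module.Finite (MoritaRing C) (U.toModule C) := by
  obtain ⟨P, Q, _, _, _, _, _, _, _, _, s, r, hs, hr⟩ := h
  have e : r.toLin C ∘ₗ s.toLin C = LinearMap.id :=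
    LinearMap.ext fun v => Prod.ext (hs v.1) (hr v.2)
  have := projective_free (C := C) (P := P) (Q := Q)
  have := finite_toModule (C := C) (free A B M N P Q)
  exact ⟨Module.Projective.of_split _ _ e,
    Module.Finite.of_surjective (r.toLin C) fun t => ⟨s.toLin C t, LinearMap.congr_fun e t⟩⟩

-- Necessity enters here: syzygies and cosyzygies over `MoritaRing C` are transported to quadruples,
-- where `IsResolvingClass.isMonicGP` applies.
variable (C) in
theorem isResolvingClass_gorensteinProjective :
    IsResolvingClass (fun G : MoritaTuple A B M N =>
      IsGorensteinProjective (MoritaRing C) (G.toModule C)) where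
  right G hG := by
    obtain ⟨P, G', _, _, _, _, i, p, _, _, hip, hG'⟩ := hG.exists_right
    let e := MoritaRing.tupleEquiv C P
    let e' := MoritaRing.tupleEquiv C G'
    have h := (hip.equiv_middle e.symm).comp_equiv e'.symm
    obtain ⟨ι, hι⟩ := exists_toLin_eq (e.symm.toLinearMap ∘ₗ i)
    obtain ⟨π, hπ⟩ := exists_toLin_eq
      (e'.symm.toLinearMap ∘ₗ p ∘ₗ e.symm.symm.toLinearMap)
    rw [← hι, ← hπ] at h
    have := Module.Finite.equiv e.symm
    have := Module.Projective.of_equiv' e.symm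
    exact ⟨_, _, ι, π, perf_of_projective (C := C), isShortExact_toLin_iff.1 h, hG'.of_equiv e'⟩
  left G hG := by
    obtain ⟨K, P, _, _, _, _, i, p, _, _, hip, hK, hext⟩ := hG.exists_left
    let e := MoritaRing.tupleEquiv C P
    let e' := MoritaRing.tupleEquiv C K
    have h := (hip.equiv_comp e').equiv_middle e.symm
    obtain ⟨ι, hι⟩ := exists_toLin_eq (e.symm.toLinearMap ∘ₗ i ∘ₗ e'.toLinearMap)
    obtain ⟨π, hπ⟩ := exists_toLin_eq (p ∘ₗ e.symm.symm.toLinearMap)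
    rw [← hι, ← hπ] at h
    have := Module.Finite.equiv e.symm
    have := Module.Projective.of_equiv' e.symm
    refine ⟨_, _, ι, π, perf_of_projective (C := C), isShortExact_toLin_iff.1 h, hK.of_equiv e',
      fun V hV φ => ?_⟩
    obtain ⟨_, _⟩ := hV.projective_and_finite (C := C)
    obtain ⟨k, hk⟩ := hG.extVanishing _ _ _ _ h _ (φ.toLin C)
    obtain ⟨κ, rfl⟩ := exists_toLin_eq k
    exact ⟨κ, fun x => congrArg Prod.fst (LinearMap.congr_fun hk (pair C _ x 0)),
      fun y => congrArg Prod.snd (LinearMap.congr_fun hk (pair C _ 0 y))⟩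

-- Sufficiency enters here: a resolving class of quadruples yields a class of `MoritaRing C`-modules
-- to which the coinductive principle applies.
variable (C) in
theorem IsResolvingClass.gorensteinProjective {𝒯 : MoritaTuple A B M N → Prop}
    (h : IsResolvingClass 𝒯) {G : MoritaTuple A B M N} (hG : 𝒯 G) :
    IsGorensteinProjective (MoritaRing C) (G.toModule C) := by
  refine IsGorensteinProjective.of_class (fun Z _ _ => ∃ G : MoritaTuple A B M N, 𝒯 G ∧
    Nonempty (Z ≃ₗ[MoritaRing C] G.toModule C)) ?_ ?_ _ ⟨G, hG, ⟨LinearEquiv.refl _ _⟩⟩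
  · rintro Z _ _ ⟨G, hG, ⟨e⟩⟩
    obtain ⟨U, G', i, p, hU, hses, hG'⟩ := h.right _ hG
    obtain ⟨h1, h2⟩ := hU.projective_and_finite (C := C)
    exact ⟨_, _, _, _, _, _, _, _, h2, h1, (isShortExact_toLin_iff.2 hses).equiv_comp e,
      G', hG', ⟨LinearEquiv.refl _ _⟩⟩
  · rintro Z _ _ ⟨G, hG, ⟨e⟩⟩
    obtain ⟨K, U, i, p, hU, hses, hK, hext⟩ := h.left _ hG
    obtain ⟨h1, h2⟩ := hU.projective_and_finite (C := C)
    refine ⟨_, _, _, _, _, _, _, _, h2, h1, (isShortExact_toLin_iff.2 hses).comp_equiv e.symm,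
      ⟨K, hK, ⟨LinearEquiv.refl _ _⟩⟩, ?_⟩
    intro V _ _ _ _ δ
    let e' := MoritaRing.tupleEquiv C V
    have := Module.Finite.equiv e'.symm
    have := Module.Projective.of_equiv' e'.symm
    obtain ⟨φ, hφ⟩ := exists_toLin_eq (e'.symm.toLinearMap ∘ₗ δ)
    obtain ⟨k, hk, hk'⟩ := hext _ (perf_of_projective (C := C)) φ
    refine ⟨e'.toLinearMap ∘ₗ k.toLin C, LinearMap.ext fun v => ?_⟩
    have : k.toLin C (i.toLin C v) = φ.toLin C v := Prod.ext (hk v.1) (hk' v.2)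
    simp [this, hφ]

end MoritaTuple

end MoritaTuple

theorem proposition1p4
    {R : Type*} [CommRing R] [IsArtinianRing R]
    {A B : Type u} [Ring A] [Ring B] [Algebra R A] [Algebra R B]
    [Module.Finite R A] [Module.Finite R B]
    {M N : Type u}
    [AddCommGroup M] [Module B M] [Module Aᵐᵒᵖ M] [SMulCommClass B Aᵐᵒᵖ M]
    [AddCommGroup N] [Module A N] [Module Bᵐᵒᵖ N] [SMulCommClass A Bᵐᵒᵖ N]
    [Module R M] [IsScalarTower R B M] [IsScalarTower R Aᵐᵒᵖ M] [Module.Finite R M]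
    [Module R N] [IsScalarTower R A N] [IsScalarTower R Bᵐᵒᵖ N] [Module.Finite R N]
    [Module.Projective B M] [Module.Projective Aᵐᵒᵖ M]
    [Module.Projective A N] [Module.Projective Bᵐᵒᵖ N]
    [Subsingleton (BalancedTensor A M N)] [Subsingleton (BalancedTensor B N M)]
    (C : MoritaDatum A B M N)
    {X Y : Type u} [AddCommGroup X] [Module A X] [Module.Finite A X]
    [AddCommGroup Y] [Module B Y] [Module.Finite B Y]
    (f : BalancedTensor A M X →ₗ[B] Y) (g : BalancedTensor B N Y →ₗ[A] X) :
    IsGorensteinProjective (MoritaRing C) (MoritaModule C f g) ↔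
      IsMonicMoritaModule f g ∧
        IsGorensteinProjective B (Y ⧸ LinearMap.range f) ∧
        IsGorensteinProjective A (X ⧸ LinearMap.range g) := by
  -- Finite generation over `R` passes to all four one-sided structures, which supplies the finite
  -- dual bases used for the tensor functors.
  have : Module.Finite B M := Module.Finite.of_restrictScalars_finite R B M
  have : Module.Finite Aᵐᵒᵖ M := Module.Finite.of_restrictScalars_finite R Aᵐᵒᵖ M
  have : Module.Finite A N := Module.Finite.of_restrictScalars_finite R A N
  have : Module.Finite Bᵐᵒᵖ N := Module.Finite.of_restrictScalars_finite R Bᵐᵒᵖ N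
  let G : MoritaTuple A B M N := { X := X, Y := Y, f := f, g := g }
  constructor
  · intro h
    have hG := (MoritaTuple.isResolvingClass_gorensteinProjective C).isMonicGP (G := G) h
    exact ⟨⟨hG.injective_f, hG.injective_g⟩, hG.cok_f, hG.cok_g⟩
  · rintro ⟨⟨hf, hg⟩, hcf, hcg⟩
    exact MoritaTuple.isResolvingClass_isMonicGP.gorensteinProjective C (G := G) ⟨hg, hf, hcg, hcf⟩
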